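/- **Setting.** Let $(x^1,x^2,x^3,x^4)=(\xi^1,\xi^2,\underline u,u)$ be the Cartesian coordinates on an open set $\mathcal U\subset\mathbb R^4$, let $$\mathcal R=\{(e,\gamma,w)\in\mathbb C^5\oplus\mathbb C^8\oplus\mathbb C^5 : e_3,e_4,e_5,\gamma_2,\gamma_6\in\mathbb R\}$$ (a real vector space of dimension 31), and let $\Phi=(e,\gamma,w):\mathcal U\to\mathcal R$ be a $C^2$ field satisfying, at every point of $\mathcal U$, $$(\star)\quad e_3>0,\qquad\qquad (\star\star)\quad \Im(e_1\overline e_2)\neq 0 .$$ Put $D=e_1\partial_{\xi^1}+e_2\partial_{\xi^2}$, $N=e_4\partial_{\xi^1}+e_5\partial_{\xi^2}+\partial_u$, $L=e_3\partial_{\underline u}$, and $(F_1,F_2,F_3,F_4)=(D,\overline D,N,L)$, a complex frame. Let $\mathbf g_{ab}$ be the symmetric matrix with $\mathbf g_{12}=\mathbf g_{21}=1$, $\mathbf g_{34}=\mathbf g_{43}=-1$ and all other entries $0$, let $\mathbf g^{ab}$ be its inverse, and let $\mathbf g$ be the complex bilinear metric on $\mathcal U$ with $\mathbf g(F_a,F_b)=\mathbf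 g_{ab}$. Let $\boldsymbol\Gamma_{ajk}=-\boldsymbol\Gamma_{akj}$ and $\mathbf W_{abjk}=-\mathbf W_{bajk}=-\mathbf W_{abkj}$ be given, with $(ab)$ and $(jk)$ running over $(12),(31),(32),(41),(42),(34)$, by $$(\boldsymbol\Gamma_{a(jk)})=\begin{pmatrix}\gamma_3+\overline\gamma_4&\overline\gamma_7&\gamma_6&\gamma_1&\gamma_2&\gamma_3-\overline\gamma_4\\ -\gamma_4-\overline\gamma_3&\gamma_6&\gamma_7&\gamma_2&\overline\gamma_1&-\gamma_4+\overline\gamma_3\\ \gamma_8-\overline\gamma_8&0&0&-\gamma_3+\overline\gamma_4&\gamma_4-\overline\gamma_3&\gamma_8+\overline\gamma_8\\ 0&\overline\gamma_5&\gamma_5&0&0&0\end{pmatrix},$$ $$(\mathbf W_{(ab)(jk)})=\begin{pmatrix}w_3+\overline w_3&\overline w_4&-w_4&w_2&-\overline w_2&w_3-\overline w_3\\ \overline w_4&\overline w_5&0&0&-\overline w_3&-\overline w_4\\ -w_4&0&w_5&-w_3&0&-w_4\\ w_2&0&-w_3&w_1&0&w_2\\ -\overline w_2&-\overline w_3&0&0&\overline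 w_1&\overline w_2\\ w_3-\overline w_3&-\overline w_4&-w_4&w_2&\overline w_2&w_3+\overline w_3\end{pmatrix}.$$ **Vacuum field.** $\Phi$ is a *vacuum field* on $\mathcal U$ if $(\star)$ and $(\star\star)$ hold on $\mathcal U$ and, with $\nabla$ the Levi-Civita connection of $\mathbf g$, i.e. $\mathbf g(\nabla_{F_a}F_j,F_k)=\tfrac12\big(-\mathbf g(F_a,[F_j,F_k])+\mathbf g(F_k,[F_a,F_j])+\mathbf g(F_j,[F_k,F_a])\big)$, the following hold everywhere on $\mathcal U$: * $\mathbf g(\nabla_{F_a}F_j,F_k)=\boldsymbol\Gamma_{ajk}$ for all $a,j,k$; * $\mathbf g\big([\nabla_{F_j},\nabla_{F_k}]F_b-\nabla_{[F_j,F_k]}F_b,\,F_a\big)=\mathbf W_{abjk}$ for all $a,b,j,k$; * $\underline u$ and $u$ solve the eikonal equation $\mathbf g^{ab}F_a(f)F_b(f)=0$; moreover $e_3N=-\operatorname{grad}\underline u$ and $L=-\operatorname{grad}u$, where $\operatorname{grad}f=\mathbf g^{ab}F_a(f)F_b$, and $X=e_3N$ and $X=L$ are null geodesic vector fields, i.e.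 $\mathbf g(X,X)=0$ and $\nabla_XX=0$. **(SHS).** For functions $\lambda_1,\dots,\lambda_4:\mathcal U\to(0,\infty)$ (weights), (SHS) is the following system on $\mathcal U$. $$\begin{aligned} L(e_1)&=-e_1\gamma_2-\overline e_1\gamma_1,\qquad L(e_2)=-e_2\gamma_2-\overline e_2\gamma_1,\qquad N(e_3)=2e_3\Re\gamma_8,\\ L(e_4)&=2\Re(-e_1\gamma_4+e_1\gamma_5+e_1\overline\gamma_3),\qquad L(e_5)=2\Re(-e_2\gamma_4+e_2\gamma_5+e_2\overline\gamma_3),\\ L(\gamma_1)&=-2\gamma_1\gamma_2-w_1,\qquad L(\gamma_2)=-|\gamma_1|^2-\gamma_2^2,\\ L(\gamma_3)&=\gamma_1\gamma_4-\gamma_1\gamma_5-\gamma_2\gamma_3-w_2,\qquad L(\gamma_4)=-\gamma_2\gamma_4+\gamma_2\gamma_5+\gamma_3\overline\gamma_1,\\ N(\gamma_5)&=-\gamma_3\gamma_7+\gamma_4\gamma_6-\gamma_5\gamma_6-\gamma_5\gamma_8+\gamma_5\overline\gamma_8-\gamma_6\overline\gamma_3+\gamma_7\overline\gamma_4-\gamma_7\overline\gamma_5+w_4,\\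 N(\gamma_6)&=-\gamma_6^2-2\gamma_6\Re\gamma_8-|\gamma_7|^2,\qquad N(\gamma_7)=-2\gamma_6\gamma_7-3\gamma_7\gamma_8+\gamma_7\overline\gamma_8-w_5,\\ L(\gamma_8)&=-2\gamma_3\gamma_4+2\gamma_3\gamma_5+\gamma_3\overline\gamma_3+\gamma_4\overline\gamma_4-\gamma_4\overline\gamma_5-\gamma_5\overline\gamma_4+w_3, \end{aligned}$$ $$\begin{pmatrix}\lambda_1N&\lambda_1D&0&0&0\\ \lambda_1\overline D&\lambda_1L+\lambda_2N&\lambda_2D&0&0\\ 0&\lambda_2\overline D&\lambda_2L+\lambda_3N&\lambda_3D&0\\ 0&0&\lambda_3\overline D&\lambda_3L+\lambda_4N&\lambda_4D\\ 0&0&0&\lambda_4\overline D&\lambda_4L\end{pmatrix}\begin{pmatrix}w_1\\w_2\\w_3\\w_4\\w_5\end{pmatrix}=\begin{pmatrix}f_1\\f_2\\f_3\\f_4\\f_5\end{pmatrix},$$ $$\begin{aligned} f_1&=-\lambda_1(3\gamma_1w_3-6\gamma_3w_2+\gamma_6w_1-4\gamma_8w_1+4\overline\gamma_4w_2),\\ f_2&=-\lambda_1(4\gamma_2w_2+4\gamma_4w_1+\gamma_5w_1)-\lambda_2(2\gamma_1w_4-3\gamma_3w_3+2\gamma_6w_2-2\gamma_8w_2+3\overline\gamma_4w_3),\\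 f_3&=-\lambda_2(3\gamma_2w_3+2\gamma_4w_2+2\gamma_5w_2+\gamma_7w_1)-\lambda_3(\gamma_1w_5+3\gamma_6w_3+2\overline\gamma_4w_4),\\ f_4&=-\lambda_3(2\gamma_2w_4+3\gamma_5w_3+2\gamma_7w_2)-\lambda_4(3\gamma_3w_5+4\gamma_6w_4+2\gamma_8w_4+\overline\gamma_4w_5),\\ f_5&=-\lambda_4(\gamma_2w_5-2\gamma_4w_4+4\gamma_5w_4+3\gamma_7w_3). \end{aligned}$$ **Constraint field.** $\Phi^\sharp=((t_1,\dots,t_5),(u_1,\dots,u_9),(v_1,v_2,v_3))$ is given by $$\begin{aligned} t_j&=-2\Im\big(D(\overline e_j)+\overline e_j\gamma_3+\overline e_j\overline\gamma_4\big)\quad(j=1,2),\qquad t_3=D(e_3)-e_3\gamma_3+e_3\overline\gamma_4+e_3\overline\gamma_5,\\ t_{j+3}&=\overline D(e_{j+3})-N(\overline e_j)-e_j\gamma_7-\overline e_j\gamma_6+\overline e_j\overline\gamma_8-\overline e_j\gamma_8\quad(j=1,2),\\ u_1&=D(\gamma_2)-\overline D(\gamma_1)+w_2-3\gamma_1\gamma_4-\gamma_1\overline\gamma_3-\gamma_2\gamma_3+\gamma_2\overline\gamma_4,\\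 u_2&=D(\gamma_4)+\overline D(\gamma_3)-w_3+2\gamma_3\gamma_4+\gamma_1\gamma_7-\gamma_2\gamma_6+\gamma_3\overline\gamma_3+\gamma_4\overline\gamma_4,\\ u_3&=\overline D(\gamma_3)-\overline D(\overline\gamma_4)+N(\gamma_2)-w_3+2\gamma_3\gamma_4-2\gamma_4\overline\gamma_4+\gamma_1\gamma_7+\gamma_2\gamma_6-\gamma_2\gamma_8-\gamma_2\overline\gamma_8,\\ u_4&=D(\overline\gamma_4)-D(\gamma_3)-N(\gamma_1)+3\gamma_1\gamma_8+2\gamma_3\gamma_3-2\gamma_3\overline\gamma_4-\gamma_1\gamma_6-\gamma_1\overline\gamma_8-\gamma_2\overline\gamma_7,\\ u_5&=\overline D(\gamma_5)-L(\gamma_7)-\gamma_2\gamma_7-\gamma_4\gamma_5+\gamma_5\gamma_5-\gamma_5\overline\gamma_3-\gamma_6\overline\gamma_1,\\ u_6&=L(\gamma_6)-D(\gamma_5)-w_3+\gamma_1\gamma_7+\gamma_2\gamma_6-\gamma_3\gamma_5-\gamma_5\overline\gamma_4-\gamma_5\overline\gamma_5,\\ u_7&=D(\gamma_8)-N(\gamma_3)-2\gamma_3\gamma_6+\gamma_3\gamma_8-\gamma_3\overline\gamma_8+\gamma_4\overline\gamma_7+\gamma_6\overline\gamma_4,\\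 u_8&=N(\gamma_4)+\overline D(\gamma_8)+w_4-2\gamma_3\gamma_7+\gamma_4\gamma_6+\gamma_4\gamma_8-\gamma_4\overline\gamma_8+\gamma_7\overline\gamma_4,\\ u_9&=D(\gamma_7)-\overline D(\gamma_6)-w_4+3\gamma_3\gamma_7+\gamma_4\gamma_6-\gamma_6\overline\gamma_3+\gamma_7\overline\gamma_4,\\ v_1&=\lambda_1\big(\overline D(w_1)+L(w_2)+4\gamma_2w_2+4\gamma_4w_1+\gamma_5w_1\big),\\ v_2&=\lambda_2\big(\overline D(w_2)+L(w_3)+3\gamma_2w_3+2\gamma_4w_2+2\gamma_5w_2+\gamma_7w_1\big),\\ v_3&=\lambda_3\big(\overline D(w_3)+L(w_4)+2\gamma_2w_4+3\gamma_5w_3+2\gamma_7w_2\big). \end{aligned}$$ **Proposition.** For $\mathcal U$ and $\Phi$ as above, $\Phi$ is a vacuum field on $\mathcal U$ if and only if there exist strictly positive functions $\lambda_1,\lambda_2,\lambda_3,\lambda_4$ on $\mathcal U$ such that $\Phi$ solves (SHS) on $\mathcal U$ and $\Phi^\sharp=0$ everywhere on $\mathcal U$. -/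

import Mathlib

open scoped ComplexConjugate Matrix

noncomputable section

namespace Wavefront

/-! ### Complex scalar fields and complex vector fields on `ℝ⁴`

Coordinates are `(x 0, x 1, x 2, x 3) = (ξ¹, ξ², u̲, u)`.  All indices are counted from zero, so the
mathematical index `j` is the Lean index `j - 1`. -/

/-- Complex valued functions on `ℝ⁴`. -/
abbrev ScalarField : Type := (Fin 4 → ℝ) → ℂ

/-- Complex vector fields `X = X^μ ∂/∂x^μ` on `ℝ⁴` (sections of the complexified tangent bundle). -/
abbrev VecField : Type := (Fin 4 → ℝ) → Fin 4 → ℂ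

/-- The coordinate derivative `∂f/∂x^μ`. -/
def coordDeriv (μ : Fin 4) (f : ScalarField) : ScalarField :=
  fun x => fderiv ℝ f x (Pi.single μ 1)

/-- `X(f) = X^μ ∂f/∂x^μ`. -/
def act (X : VecField) (f : ScalarField) : ScalarField :=
  fun x => ∑ μ, X x μ * coordDeriv μ f x

/-- The commutator `[X, Y]` of vector fields, `[X, Y]^μ = X(Y^μ) - Y(X^μ)`. -/
def bracket (X Y : VecField) : VecField :=
  fun x μ => act X (fun y => Y y μ) x - act Y (fun y => X y μ) x

/-- The product `f X` of a function and a vector field. -/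
def scale (f : ScalarField) (X : VecField) : VecField :=
  fun x μ => f x * X x μ

/-- The real part of a function, as a complex valued function. -/
def rePart (f : ScalarField) : ScalarField := fun x => ((f x).re : ℂ)

/-- The imaginary part of a function, as a complex valued function. -/
def imPart (f : ScalarField) : ScalarField := fun x => ((f x).im : ℂ)

/-! ### The field `Φ = (e, γ, w)` -/

/-- The space `ℂ⁵ ⊕ ℂ⁸ ⊕ ℂ⁵`. -/
abbrev FieldSpace : Type := (Fin 5 → ℂ) × (Fin 8 → ℂ) × (Fin 5 → ℂ)

/-- The 31 dimensional real vector space `𝓡` of all `(e, γ, w) ∈ ℂ⁵ ⊕ ℂ⁸ ⊕ ℂ⁵` for which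
`e₃, e₄, e₅, γ₂, γ₆` are real. -/
def fieldRange : Set FieldSpace :=
  {p | (p.1 2).im = 0 ∧ (p.1 3).im = 0 ∧ (p.1 4).im = 0 ∧ (p.2.1 1).im = 0 ∧ (p.2.1 5).im = 0}

/-- The component functions `e₁, …, e₅` of `Φ`. -/
def eComp (Φ : (Fin 4 → ℝ) → FieldSpace) (j : Fin 5) : ScalarField := fun x => (Φ x).1 j

/-- The component functions `γ₁, …, γ₈` of `Φ`. -/
def gammaComp (Φ : (Fin 4 → ℝ) → FieldSpace) (j : Fin 8) : ScalarField := fun x => (Φ x).2.1 j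

/-- The component functions `w₁, …, w₅` of `Φ`. -/
def wComp (Φ : (Fin 4 → ℝ) → FieldSpace) (j : Fin 5) : ScalarField := fun x => (Φ x).2.2 j

/-- Condition `(⋆)` on `U`: `e₃ > 0` (for `𝓡`-valued `Φ`, `e₃` is real). -/
def ConditionStar (U : Set (Fin 4 → ℝ)) (Φ : (Fin 4 → ℝ) → FieldSpace) : Prop :=
  ∀ x ∈ U, 0 < (eComp Φ 2 x).re

/-- Condition `(⋆⋆)` on `U`: `Im (e₁ ē₂) ≠ 0`. -/
def ConditionStarStar (U : Set (Fin 4 → ℝ)) (Φ : (Fin 4 → ℝ) → FieldSpace) : Prop :=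
  ∀ x ∈ U, (eComp Φ 0 x * conj (eComp Φ 1 x)).im ≠ 0

/-! ### The frame, the connection symbols and the Weyl symbols associated to `Φ` -/

/-- The matrix `F_a^μ` (row `a`, column `μ`). -/
def frameMatrix (Φ : (Fin 4 → ℝ) → FieldSpace) (x : Fin 4 → ℝ) : Matrix (Fin 4) (Fin 4) ℂ :=
  let e₁ := eComp Φ 0 x
  let e₂ := eComp Φ 1 x
  let e₃ := eComp Φ 2 x
  let e₄ := eComp Φ 3 x
  let e₅ := eComp Φ 4 x
  !![e₁, e₂, 0, 0;
     conj e₁, conj e₂, 0, 0;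
     e₄, e₅, 0, 1;
     0, 0, e₃, 0]

/-- The frame `(F₁, F₂, F₃, F₄) = (D, D̄, N, L)`, where `D = e₁ ∂/∂ξ¹ + e₂ ∂/∂ξ²`,
`N = e₄ ∂/∂ξ¹ + e₅ ∂/∂ξ² + ∂/∂u`, `L = e₃ ∂/∂u̲`. -/
def frame (Φ : (Fin 4 → ℝ) → FieldSpace) (a : Fin 4) : VecField := fun x => frameMatrix Φ x a

/-- The ordered sequence `(12), (31), (32), (41), (42), (34)` of index pairs. -/
def indexPair : Fin 6 → Fin 4 × Fin 4 := ![(0, 1), (2, 0), (2, 1), (3, 0), (3, 1), (2, 3)]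

/-- `+1` if `(j, k)` is the `p`-th index pair, `-1` if `(k, j)` is the `p`-th index pair, `0`
otherwise.  `∑ p, pairSign p j k * m p` is the array antisymmetric in `j, k` whose entries at the six
index pairs are `m 0, …, m 5`. -/
def pairSign (p : Fin 6) (j k : Fin 4) : ℂ :=
  if indexPair p = (j, k) then 1 else if indexPair p = (k, j) then -1 else 0

/-- The matrix `Γ_{a(jk)}`, with `(jk)` running over the six index pairs. -/
def GammaTable (Φ : (Fin 4 → ℝ) → FieldSpace) (x : Fin 4 → ℝ) : Matrix (Fin 4) (Fin 6) ℂ :=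
  let γ₁ := gammaComp Φ 0 x
  let γ₂ := gammaComp Φ 1 x
  let γ₃ := gammaComp Φ 2 x
  let γ₄ := gammaComp Φ 3 x
  let γ₅ := gammaComp Φ 4 x
  let γ₆ := gammaComp Φ 5 x
  let γ₇ := gammaComp Φ 6 x
  let γ₈ := gammaComp Φ 7 x
  !![γ₃ + conj γ₄, conj γ₇, γ₆, γ₁, γ₂, γ₃ - conj γ₄;
     -γ₄ - conj γ₃, γ₆, γ₇, γ₂, conj γ₁, -γ₄ + conj γ₃;
     γ₈ - conj γ₈, 0, 0, -γ₃ + conj γ₄, γ₄ - conj γ₃, γ₈ + conj γ₈;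
     0, conj γ₅, γ₅, 0, 0, 0]

/-- The connection symbols `Γ_{ajk} = -Γ_{akj}` associated to `Φ`. -/
def Gamma (Φ : (Fin 4 → ℝ) → FieldSpace) (a j k : Fin 4) : ScalarField :=
  fun x => ∑ p, pairSign p j k * GammaTable Φ x a p

/-- The matrix `W_{(ab)(jk)}`, with `(ab)` and `(jk)` running over the six index pairs. -/
def WTable (Φ : (Fin 4 → ℝ) → FieldSpace) (x : Fin 4 → ℝ) : Matrix (Fin 6) (Fin 6) ℂ :=
  let w₁ := wComp Φ 0 x
  let w₂ := wComp Φ 1 x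
  let w₃ := wComp Φ 2 x
  let w₄ := wComp Φ 3 x
  let w₅ := wComp Φ 4 x
  !![w₃ + conj w₃, conj w₄, -w₄, w₂, -conj w₂, w₃ - conj w₃;
     conj w₄, conj w₅, 0, 0, -conj w₃, -conj w₄;
     -w₄, 0, w₅, -w₃, 0, -w₄;
     w₂, 0, -w₃, w₁, 0, w₂;
     -conj w₂, -conj w₃, 0, 0, conj w₁, conj w₂;
     w₃ - conj w₃, -conj w₄, -w₄, w₂, conj w₂, w₃ + conj w₃]

/-- The Weyl symbols `W_{abjk} = -W_{bajk} = -W_{abkj}` associated to `Φ`. -/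
def Weyl (Φ : (Fin 4 → ℝ) → FieldSpace) (a b j k : Fin 4) : ScalarField :=
  fun x => ∑ p, ∑ q, pairSign p a b * pairSign q j k * WTable Φ x p q

/-! ### The metric, its Levi-Civita connection and its Riemann tensor -/

/-- The constant matrix `g_{ab}`. -/
def gLower : Matrix (Fin 4) (Fin 4) ℂ :=
  !![0, 1, 0, 0;
     1, 0, 0, 0;
     0, 0, 0, -1;
     0, 0, -1, 0]

/-- The constant matrix `g^{ab}`, the inverse of `g_{ab}`. -/
def gUpper : Matrix (Fin 4) (Fin 4) ℂ :=
  !![0, 1, 0, 0;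
     1, 0, 0, 0;
     0, 0, 0, -1;
     0, 0, -1, 0]

theorem gLower_mul_gUpper : gLower * gUpper = 1 := by
  ext i j
  fin_cases i <;> fin_cases j <;>
    simp [gLower, gUpper, Matrix.mul_apply, Fin.sum_univ_four]

/-- The components `X^a` of a vector field with respect to the frame, `X = X^a F_a`. -/
def coeff (Φ : (Fin 4 → ℝ) → FieldSpace) (X : VecField) (x : Fin 4 → ℝ) : Fin 4 → ℂ :=
  X x ᵥ* (frameMatrix Φ x)⁻¹

/-- The complex bilinear metric with `g(F_a, F_b) = g_{ab}`. -/
def metric (Φ : (Fin 4 → ℝ) → FieldSpace) (X Y : VecField) : ScalarField :=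
  fun x => ∑ a, ∑ b, gLower a b * coeff Φ X x a * coeff Φ Y x b

/-- The Levi-Civita connection in the frame, `g(∇_{F_a} F_j, F_k)`, by the Koszul formula (recall that
the functions `g(F_a, F_b)` are constant). -/
def koszul (Φ : (Fin 4 → ℝ) → FieldSpace) (a j k : Fin 4) : ScalarField :=
  fun x => (1 / 2 : ℂ) *
    (-metric Φ (frame Φ a) (bracket (frame Φ j) (frame Φ k)) x
      + metric Φ (frame Φ k) (bracket (frame Φ a) (frame Φ j)) x
      + metric Φ (frame Φ j) (bracket (frame Φ k) (frame Φ a)) x)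

/-- The Levi-Civita covariant derivative `∇_X Y` of vector fields: with `X = X^a F_a`, `Y = Y^b F_b`,
`∇_X Y = X(Y^c) F_c + X^a Y^b g(∇_{F_a} F_b, F_d) g^{dc} F_c`. -/
def covDeriv (Φ : (Fin 4 → ℝ) → FieldSpace) (X Y : VecField) : VecField :=
  fun x μ => ∑ c,
    (act X (fun y => coeff Φ Y y c) x
      + ∑ a, ∑ b, ∑ d, coeff Φ X x a * coeff Φ Y x b * koszul Φ a b d x * gUpper d c)
    * frame Φ c x μ

/-- The Riemann tensor `R_{abjk} = g([∇_{F_j}, ∇_{F_k}] F_b - ∇_{[F_j, F_k]} F_b, F_a)`. -/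
def riemann (Φ : (Fin 4 → ℝ) → FieldSpace) (a b j k : Fin 4) : ScalarField :=
  metric Φ
    (covDeriv Φ (frame Φ j) (covDeriv Φ (frame Φ k) (frame Φ b))
      - covDeriv Φ (frame Φ k) (covDeriv Φ (frame Φ j) (frame Φ b))
      - covDeriv Φ (bracket (frame Φ j) (frame Φ k)) (frame Φ b))
    (frame Φ a)

/-- The gradient `g^{ab} F_a(f) F_b` of a function. -/
def gradient (Φ : (Fin 4 → ℝ) → FieldSpace) (f : ScalarField) : VecField :=
  fun x μ => ∑ a, ∑ b, gUpper a b * act (frame Φ a) f x * frame Φ b x μ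

/-- The eikonal equation `g^{ab} F_a(f) F_b(f) = 0` on `U`. -/
def SolvesEikonal (U : Set (Fin 4 → ℝ)) (Φ : (Fin 4 → ℝ) → FieldSpace) (f : ScalarField) : Prop :=
  ∀ x ∈ U, ∑ a, ∑ b, gUpper a b * act (frame Φ a) f x * act (frame Φ b) f x = 0

/-- `X` is a null geodesic vector field on `U`: `g(X, X) = 0` and `∇_X X = 0`. -/
def IsNullGeodesic (U : Set (Fin 4 → ℝ)) (Φ : (Fin 4 → ℝ) → FieldSpace) (X : VecField) : Prop :=
  ∀ x ∈ U, metric Φ X X x = 0 ∧ covDeriv Φ X X x = 0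

/-- The coordinate function `u̲ = x³`. -/
def ubarCoord : ScalarField := fun x => (x 2 : ℂ)

/-- The coordinate function `u = x⁴`. -/
def uCoord : ScalarField := fun x => (x 3 : ℂ)

/-- Vacuum fields on `U`. -/
structure IsVacuumField (U : Set (Fin 4 → ℝ)) (Φ : (Fin 4 → ℝ) → FieldSpace) : Prop where
  star : ConditionStar U Φ
  starStar : ConditionStarStar U Φ
  connection : ∀ x ∈ U, ∀ a j k, koszul Φ a j k x = Gamma Φ a j k x
  curvature : ∀ x ∈ U, ∀ a b j k, riemann Φ a b j k x = Weyl Φ a b j k x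
  eikonal_ubar : SolvesEikonal U Φ ubarCoord
  eikonal_u : SolvesEikonal U Φ uCoord
  gradient_ubar : ∀ x ∈ U, scale (eComp Φ 2) (frame Φ 2) x = -gradient Φ ubarCoord x
  gradient_u : ∀ x ∈ U, frame Φ 3 x = -gradient Φ uCoord x
  geodesic_ubar : IsNullGeodesic U Φ (scale (eComp Φ 2) (frame Φ 2))
  geodesic_u : IsNullGeodesic U Φ (frame Φ 3)

/-! ### The quasilinear symmetric hyperbolic system -/

/-- A matrix of vector fields, applied as a matrix differential operator to a column of functions. -/
def applyOp {n : ℕ} (A : Matrix (Fin n) (Fin n) VecField) (ψ : Fin n → ScalarField) :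
    Fin n → ScalarField :=
  fun i x => ∑ j, act (A i j) (ψ j) x

/-- The operator `A₁(Φ)`. -/
def opA₁ (Φ : (Fin 4 → ℝ) → FieldSpace) : Matrix (Fin 5) (Fin 5) VecField :=
  let N := frame Φ 2
  let L := frame Φ 3
  Matrix.diagonal ![L, L, N, L, L]

/-- The operator `A₂(Φ)`. -/
def opA₂ (Φ : (Fin 4 → ℝ) → FieldSpace) : Matrix (Fin 8) (Fin 8) VecField :=
  let N := frame Φ 2
  let L := frame Φ 3
  Matrix.diagonal ![L, L, L, L, N, N, N, L]

/-- The operator `A₃(Φ)`, with weights `λ₁, λ₂, λ₃, λ₄`. -/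
def opA₃ (lam : Fin 4 → (Fin 4 → ℝ) → ℝ) (Φ : (Fin 4 → ℝ) → FieldSpace) :
    Matrix (Fin 5) (Fin 5) VecField :=
  let D := frame Φ 0
  let Db := frame Φ 1
  let N := frame Φ 2
  let L := frame Φ 3
  let l₁ : ScalarField := fun x => (lam 0 x : ℂ)
  let l₂ : ScalarField := fun x => (lam 1 x : ℂ)
  let l₃ : ScalarField := fun x => (lam 2 x : ℂ)
  let l₄ : ScalarField := fun x => (lam 3 x : ℂ)
  !![scale l₁ N, scale l₁ D, 0, 0, 0;
     scale l₁ Db, scale l₁ L + scale l₂ N, scale l₂ D, 0, 0;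
     0, scale l₂ Db, scale l₂ L + scale l₃ N, scale l₃ D, 0;
     0, 0, scale l₃ Db, scale l₃ L + scale l₄ N, scale l₄ D;
     0, 0, 0, scale l₄ Db, scale l₄ L]

/-- The right hand side `f₁(Φ)`. -/
def rhs₁ (Φ : (Fin 4 → ℝ) → FieldSpace) : Fin 5 → ScalarField :=
  let e₁ := eComp Φ 0
  let e₂ := eComp Φ 1
  let e₃ := eComp Φ 2
  let γ₁ := gammaComp Φ 0
  let γ₂ := gammaComp Φ 1
  let γ₃ := gammaComp Φ 2
  let γ₄ := gammaComp Φ 3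
  let γ₅ := gammaComp Φ 4
  let γ₈ := gammaComp Φ 7
  ![-e₁ * γ₂ - conj e₁ * γ₁,
    -e₂ * γ₂ - conj e₂ * γ₁,
    e₃ * 2 * rePart γ₈,
    2 * rePart (-e₁ * γ₄ + e₁ * γ₅ + e₁ * conj γ₃),
    2 * rePart (-e₂ * γ₄ + e₂ * γ₅ + e₂ * conj γ₃)]

/-- The right hand side `f₂(Φ)`. -/
def rhs₂ (Φ : (Fin 4 → ℝ) → FieldSpace) : Fin 8 → ScalarField :=
  let γ₁ := gammaComp Φ 0
  let γ₂ := gammaComp Φ 1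
  let γ₃ := gammaComp Φ 2
  let γ₄ := gammaComp Φ 3
  let γ₅ := gammaComp Φ 4
  let γ₆ := gammaComp Φ 5
  let γ₇ := gammaComp Φ 6
  let γ₈ := gammaComp Φ 7
  let w₁ := wComp Φ 0
  let w₂ := wComp Φ 1
  let w₃ := wComp Φ 2
  let w₄ := wComp Φ 3
  let w₅ := wComp Φ 4
  ![-2 * γ₁ * γ₂ - w₁,
    -γ₁ * conj γ₁ - γ₂ * γ₂,
    γ₁ * γ₄ - γ₁ * γ₅ - γ₂ * γ₃ - w₂,
    -γ₂ * γ₄ + γ₂ * γ₅ + γ₃ * conj γ₁,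
    -γ₃ * γ₇ + γ₄ * γ₆ - γ₅ * γ₆ - γ₅ * γ₈ + γ₅ * conj γ₈ - γ₆ * conj γ₃ + γ₇ * conj γ₄
      - γ₇ * conj γ₅ + w₄,
    -γ₆ * γ₆ - γ₆ * 2 * rePart γ₈ - γ₇ * conj γ₇,
    -2 * γ₆ * γ₇ - 3 * γ₇ * γ₈ + γ₇ * conj γ₈ - w₅,
    -2 * γ₃ * γ₄ + 2 * γ₃ * γ₅ + γ₃ * conj γ₃ + γ₄ * conj γ₄ - γ₄ * conj γ₅ - γ₅ * conj γ₄ + w₃]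

/-- The right hand side `f₃(Φ)`, with weights `λ₁, λ₂, λ₃, λ₄`. -/
def rhs₃ (lam : Fin 4 → (Fin 4 → ℝ) → ℝ) (Φ : (Fin 4 → ℝ) → FieldSpace) : Fin 5 → ScalarField :=
  let l₁ : ScalarField := fun x => (lam 0 x : ℂ)
  let l₂ : ScalarField := fun x => (lam 1 x : ℂ)
  let l₃ : ScalarField := fun x => (lam 2 x : ℂ)
  let l₄ : ScalarField := fun x => (lam 3 x : ℂ)
  let γ₁ := gammaComp Φ 0
  let γ₂ := gammaComp Φ 1
  let γ₃ := gammaComp Φ 2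
  let γ₄ := gammaComp Φ 3
  let γ₅ := gammaComp Φ 4
  let γ₆ := gammaComp Φ 5
  let γ₇ := gammaComp Φ 6
  let γ₈ := gammaComp Φ 7
  let w₁ := wComp Φ 0
  let w₂ := wComp Φ 1
  let w₃ := wComp Φ 2
  let w₄ := wComp Φ 3
  let w₅ := wComp Φ 4
  ![-l₁ * (3 * γ₁ * w₃ - 6 * γ₃ * w₂ + γ₆ * w₁ - 4 * γ₈ * w₁ + 4 * conj γ₄ * w₂),
    -l₁ * (4 * γ₂ * w₂ + 4 * γ₄ * w₁ + γ₅ * w₁)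
      - l₂ * (2 * γ₁ * w₄ - 3 * γ₃ * w₃ + 2 * γ₆ * w₂ - 2 * γ₈ * w₂ + 3 * conj γ₄ * w₃),
    -l₂ * (3 * γ₂ * w₃ + 2 * γ₄ * w₂ + 2 * γ₅ * w₂ + γ₇ * w₁)
      - l₃ * (γ₁ * w₅ + 3 * γ₆ * w₃ + 2 * conj γ₄ * w₄),
    -l₃ * (2 * γ₂ * w₄ + 3 * γ₅ * w₃ + 2 * γ₇ * w₂)
      - l₄ * (3 * γ₃ * w₅ + 4 * γ₆ * w₄ + 2 * γ₈ * w₄ + conj γ₄ * w₅),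
    -l₄ * (γ₂ * w₅ - 2 * γ₄ * w₄ + 4 * γ₅ * w₄ + 3 * γ₇ * w₃)]

/-- `Φ` solves the system `A(Φ) Φ = f(Φ)` on `U`, with weights `λ₁, λ₂, λ₃, λ₄`. -/
def SolvesSHS (U : Set (Fin 4 → ℝ)) (lam : Fin 4 → (Fin 4 → ℝ) → ℝ)
    (Φ : (Fin 4 → ℝ) → FieldSpace) : Prop :=
  ∀ x ∈ U,
    (∀ i, applyOp (opA₁ Φ) (eComp Φ) i x = rhs₁ Φ i x) ∧
    (∀ i, applyOp (opA₂ Φ) (gammaComp Φ) i x = rhs₂ Φ i x) ∧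
    (∀ i, applyOp (opA₃ lam Φ) (wComp Φ) i x = rhs₃ lam Φ i x)

/-! ### The constraint field `Φ♯ = (t, u, v)` -/

/-- The space `ℂ⁵ ⊕ ℂ⁹ ⊕ ℂ³`. -/
abbrev ConstraintSpace : Type := (Fin 5 → ℂ) × (Fin 9 → ℂ) × (Fin 3 → ℂ)

/-- The components `t₁, …, t₅` of the constraint field. -/
def constraintT (Φ : (Fin 4 → ℝ) → FieldSpace) : Fin 5 → ScalarField :=
  let D := act (frame Φ 0)
  let Db := act (frame Φ 1)
  let N := act (frame Φ 2)
  let e₁ := eComp Φ 0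
  let e₂ := eComp Φ 1
  let e₃ := eComp Φ 2
  let e₄ := eComp Φ 3
  let e₅ := eComp Φ 4
  let γ₃ := gammaComp Φ 2
  let γ₄ := gammaComp Φ 3
  let γ₅ := gammaComp Φ 4
  let γ₆ := gammaComp Φ 5
  let γ₇ := gammaComp Φ 6
  let γ₈ := gammaComp Φ 7
  ![-2 * imPart (D (conj e₁) + conj e₁ * γ₃ + conj e₁ * conj γ₄),
    -2 * imPart (D (conj e₂) + conj e₂ * γ₃ + conj e₂ * conj γ₄),
    D e₃ - e₃ * γ₃ + e₃ * conj γ₄ + e₃ * conj γ₅,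
    Db e₄ - N (conj e₁) - e₁ * γ₇ - conj e₁ * γ₆ + conj e₁ * conj γ₈ - conj e₁ * γ₈,
    Db e₅ - N (conj e₂) - e₂ * γ₇ - conj e₂ * γ₆ + conj e₂ * conj γ₈ - conj e₂ * γ₈]

/-- The components `u₁, …, u₉` of the constraint field. -/
def constraintU (Φ : (Fin 4 → ℝ) → FieldSpace) : Fin 9 → ScalarField :=
  let D := act (frame Φ 0)
  let Db := act (frame Φ 1)
  let N := act (frame Φ 2)
  let L := act (frame Φ 3)
  let γ₁ := gammaComp Φ 0
  let γ₂ := gammaComp Φ 1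
  let γ₃ := gammaComp Φ 2
  let γ₄ := gammaComp Φ 3
  let γ₅ := gammaComp Φ 4
  let γ₆ := gammaComp Φ 5
  let γ₇ := gammaComp Φ 6
  let γ₈ := gammaComp Φ 7
  let w₂ := wComp Φ 1
  let w₃ := wComp Φ 2
  let w₄ := wComp Φ 3
  ![D γ₂ - Db γ₁ + w₂ - 3 * γ₁ * γ₄ - γ₁ * conj γ₃ - γ₂ * γ₃ + γ₂ * conj γ₄,
    D γ₄ + Db γ₃ - w₃ + 2 * γ₃ * γ₄ + γ₁ * γ₇ - γ₂ * γ₆ + γ₃ * conj γ₃ + γ₄ * conj γ₄,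
    Db γ₃ - Db (conj γ₄) + N γ₂
      - w₃ + 2 * γ₃ * γ₄ - 2 * γ₄ * conj γ₄ + γ₁ * γ₇ + γ₂ * γ₆ - γ₂ * γ₈ - γ₂ * conj γ₈,
    D (conj γ₄) - D γ₃ - N γ₁
      + 3 * γ₁ * γ₈ + 2 * γ₃ * γ₃ - 2 * γ₃ * conj γ₄ - γ₁ * γ₆ - γ₁ * conj γ₈ - γ₂ * conj γ₇,
    Db γ₅ - L γ₇ - γ₂ * γ₇ - γ₄ * γ₅ + γ₅ * γ₅ - γ₅ * conj γ₃ - γ₆ * conj γ₁,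
    L γ₆ - D γ₅ - w₃ + γ₁ * γ₇ + γ₂ * γ₆ - γ₃ * γ₅ - γ₅ * conj γ₄ - γ₅ * conj γ₅,
    D γ₈ - N γ₃ - 2 * γ₃ * γ₆ + γ₃ * γ₈ - γ₃ * conj γ₈ + γ₄ * conj γ₇ + γ₆ * conj γ₄,
    N γ₄ + Db γ₈ + w₄ - 2 * γ₃ * γ₇ + γ₄ * γ₆ + γ₄ * γ₈ - γ₄ * conj γ₈ + γ₇ * conj γ₄,
    D γ₇ - Db γ₆ - w₄ + 3 * γ₃ * γ₇ + γ₄ * γ₆ - γ₆ * conj γ₃ + γ₇ * conj γ₄]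

/-- The components `v₁, v₂, v₃` of the constraint field, with weights `λ₁, λ₂, λ₃`. -/
def constraintV (lam : Fin 4 → (Fin 4 → ℝ) → ℝ) (Φ : (Fin 4 → ℝ) → FieldSpace) :
    Fin 3 → ScalarField :=
  let Db := act (frame Φ 1)
  let L := act (frame Φ 3)
  let l₁ : ScalarField := fun x => (lam 0 x : ℂ)
  let l₂ : ScalarField := fun x => (lam 1 x : ℂ)
  let l₃ : ScalarField := fun x => (lam 2 x : ℂ)
  let γ₂ := gammaComp Φ 1
  let γ₄ := gammaComp Φ 3
  let γ₅ := gammaComp Φ 4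
  let γ₇ := gammaComp Φ 6
  let w₁ := wComp Φ 0
  let w₂ := wComp Φ 1
  let w₃ := wComp Φ 2
  let w₄ := wComp Φ 3
  ![l₁ * (Db w₁ + L w₂ + 4 * γ₂ * w₂ + 4 * γ₄ * w₁ + γ₅ * w₁),
    l₂ * (Db w₂ + L w₃ + 3 * γ₂ * w₃ + 2 * γ₄ * w₂ + 2 * γ₅ * w₂ + γ₇ * w₁),
    l₃ * (Db w₃ + L w₄ + 2 * γ₂ * w₄ + 3 * γ₅ * w₃ + 2 * γ₇ * w₂)]

/-- The constraint field `Φ♯ = (t, u, v)` associated to `Φ` and the weights `λ₁, λ₂, λ₃, λ₄`. -/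
def constraintField (lam : Fin 4 → (Fin 4 → ℝ) → ℝ) (Φ : (Fin 4 → ℝ) → FieldSpace) :
    (Fin 4 → ℝ) → ConstraintSpace :=
  fun x => (fun j => constraintT Φ j x, fun j => constraintU Φ j x, fun j => constraintV lam Φ j x)

end Wavefront

end

open scoped ComplexConjugate Matrix

noncomputable section

namespace Wavefront

open Filter Topology

/-! ### Calculus of vector fields acting on functions -/

section Calculus

variable {x : Fin 4 → ℝ} {f g : ScalarField} {X Y : VecField}

/-! The whole statement is about the structure equations of the frame. The symbols Γ_{ajk} are skew
in j, k, so they define a connection compatible with the metric, and it is the Levi-Civita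
connection exactly when its torsion vanishes (`koszul_eq_Gamma_iff`). In coordinates the torsion
equations are the e-rows of (SHS), the constraints t = 0, and the complex conjugates of both
(`connection_iff_frameEqs`, `frameEqsAt_iff`).

Once the connection is Levi-Civita on the open set, the Riemann tensor is a polynomial in γ, γ̄ and
their first frame derivatives (`riemann_eq`). Equating it to W gives six skew matrices with six free
entries each. These 36 equations are linear combinations of the γ-rows of (SHS), the constraints u =
0 and the conjugates (`curvature_iff_connEqs`, `connEqsAt_iff`).

The w-rows and v come from the second Bianchi identity for a curvature equal to W (`bianchi`,
`weylEqs_of_bianchi`). It yields eight first order equations for w. Each of the three middle w-rows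
is a weighted sum of two of them, and v isolates one of the two, so a vacuum field satisfies the
w-system with weights 1 (`weylEqs_solves`). The identity rests on the commutation of second
derivatives of e and γ, which C² provides; w is differentiated only once.

Conversely, the e- and γ-rows with t = u = 0 are the connection and curvature conditions themselves.
The eikonal and gradient statements follow from the zeros of the frame matrix, the geodesic ones
from the zeros of Γ and the row for N(e₃).

Throughout, γ and γ̄ (likewise e and ē, w and w̄) enter explicit tables as independent arguments, so
each comparison is a polynomial identity; conjugation and the reality of e₃, e₄, e₅, γ₂, γ₆ relate
the two halves. -/

theorem act_congr (h : f =ᶠ[𝓝 x] g) (X : VecField) : act X f x = act X g x := by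
  simp only [act, coordDeriv, h.fderiv_eq]

theorem act_const (X : VecField) (c : ℂ) (x : Fin 4 → ℝ) : act X (fun _ => c) x = 0 := by
  simp [act, coordDeriv]

theorem act_add (hf : DifferentiableAt ℝ f x) (hg : DifferentiableAt ℝ g x) (X : VecField) :
    act X (fun y => f y + g y) x = act X f x + act X g x := by
  have h : fderiv ℝ (fun y => f y + g y) x = fderiv ℝ f x + fderiv ℝ g x := fderiv_add hf hg
  simp only [act, coordDeriv, h, add_apply, mul_add, Finset.sum_add_distrib]

theorem act_sub (hf : DifferentiableAt ℝ f x) (hg : DifferentiableAt ℝ g x) (X : VecField) :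
    act X (fun y => f y - g y) x = act X f x - act X g x := by
  have h : fderiv ℝ (fun y => f y - g y) x = fderiv ℝ f x - fderiv ℝ g x := fderiv_sub hf hg
  simp only [act, coordDeriv, h, sub_apply, mul_sub, Finset.sum_sub_distrib]

theorem act_mul (hf : DifferentiableAt ℝ f x) (hg : DifferentiableAt ℝ g x) (X : VecField) :
    act X (fun y => f y * g y) x = act X f x * g x + f x * act X g x := by
  have h : fderiv ℝ (fun y => f y * g y) x = f x • fderiv ℝ g x + g x • fderiv ℝ f x :=
    fderiv_mul hf hg
  simp only [act, coordDeriv, h, add_apply, smul_apply,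
    smul_eq_mul, Finset.sum_mul, Finset.mul_sum, ← Finset.sum_add_distrib]
  exact Finset.sum_congr rfl fun _ _ => by ring

theorem act_const_mul (hf : DifferentiableAt ℝ f x) (X : VecField) (c : ℂ) :
    act X (fun y => c * f y) x = c * act X f x := by
  rw [act_mul (differentiableAt_const c) hf, act_const, zero_mul, zero_add]

theorem act_sum {ι : Type*} {s : Finset ι} {f : ι → ScalarField}
    (hf : ∀ i ∈ s, DifferentiableAt ℝ (f i) x) (X : VecField) :
    act X (fun y => ∑ i ∈ s, f i y) x = ∑ i ∈ s, act X (f i) x := by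
  simp only [act, coordDeriv, fderiv_fun_sum hf, sum_apply, Finset.mul_sum]
  exact Finset.sum_comm

/-- Constant coefficient linear maps commute with the action of vector fields. -/
theorem act_linearMap {ι : Type*} [Fintype ι] [DecidableEq ι] (l : (ι → ℂ) →ₗ[ℂ] ℂ)
    {f : ι → ScalarField} (hf : ∀ i, DifferentiableAt ℝ (f i) x) (X : VecField) :
    act X (fun y => l fun i => f i y) x = l fun i => act X (f i) x := by
  have key (v : ι → ℂ) : l v = ∑ i, l (Pi.single i 1) * v i := by
    conv_lhs => rw [pi_eq_sum_univ' v, map_sum]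
    refine Finset.sum_congr rfl fun i _ => ?_
    rw [map_smul, smul_eq_mul, mul_comm]
  have h : (fun y => l fun i => f i y) = fun y => ∑ i, l (Pi.single i 1) * f i y :=
    funext fun y => key _
  rw [h, key, act_sum fun i _ => (hf i).const_mul _]
  exact Finset.sum_congr rfl fun i _ => act_const_mul (hf i) X _

theorem coordDeriv_conj (μ : Fin 4) (f : ScalarField) (x : Fin 4 → ℝ) :
    coordDeriv μ (conj f) x = conj (coordDeriv μ f x) := by
  have h : fderiv ℝ (conj f) x = (Complex.conjCLE : ℂ →L[ℝ] ℂ).comp (fderiv ℝ f x) :=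
    Complex.conjCLE.comp_fderiv (f := f) (x := x)
  simp [coordDeriv, h]

theorem act_conj {X Y : VecField} (h : ∀ μ, X x μ = conj (Y x μ)) (f : ScalarField) :
    act X (conj f) x = conj (act Y f x) := by
  simp [act, coordDeriv_conj, h]

theorem coordDeriv_comm (hf : ContDiffAt ℝ 2 f x) (μ ν : Fin 4) :
    coordDeriv μ (coordDeriv ν f) x = coordDeriv ν (coordDeriv μ f) x := by
  have hd : DifferentiableAt ℝ (fderiv ℝ f) x :=
    (hf.fderiv_right (m := 1) (by norm_num)).differentiableAt (by norm_num)
  have key (μ ν : Fin 4) : coordDeriv μ (coordDeriv ν f) x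
      = fderiv ℝ (fderiv ℝ f) x (Pi.single μ 1) (Pi.single ν 1) := by
    unfold coordDeriv
    rw [fderiv_clm_apply hd (differentiableAt_const _)]
    simp
  rw [key, key]
  exact (hf.isSymmSndFDerivAt (by simp)).eq _ _

theorem differentiableAt_coordDeriv (hf : ContDiffAt ℝ 2 f x) (μ : Fin 4) :
    DifferentiableAt ℝ (coordDeriv μ f) x :=
  ((hf.fderiv_right (m := 1) (by norm_num)).differentiableAt (by norm_num)).clm_apply
    (differentiableAt_const _)

theorem differentiableAt_act (hX : ∀ μ, DifferentiableAt ℝ (fun y => X y μ) x)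
    (hf : ContDiffAt ℝ 2 f x) : DifferentiableAt ℝ (act X f) x := by
  unfold act
  exact DifferentiableAt.fun_sum fun μ _ => (hX μ).mul (differentiableAt_coordDeriv hf μ)

theorem act_act (hY : ∀ μ, DifferentiableAt ℝ (fun y => Y y μ) x)
    (hf : ContDiffAt ℝ 2 f x) :
    act X (act Y f) x = ∑ μ, act X (fun y => Y y μ) x * coordDeriv μ f x
      + ∑ μ, ∑ ν, X x ν * Y x μ * coordDeriv ν (coordDeriv μ f) x := by
  have h : act Y f = fun y => ∑ μ, Y y μ * coordDeriv μ f y := rfl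
  rw [h, act_sum fun μ _ => (hY μ).fun_mul (differentiableAt_coordDeriv hf μ),
    ← Finset.sum_add_distrib]
  refine Finset.sum_congr rfl fun μ _ => ?_
  rw [act_mul (hY μ) (differentiableAt_coordDeriv hf μ)]
  congr 1
  simp only [act, Finset.mul_sum]
  exact Finset.sum_congr rfl fun _ _ => by ring

/-- The commutator of vector fields acts as the commutator of derivations. -/
theorem act_bracket (hX : ∀ μ, DifferentiableAt ℝ (fun y => X y μ) x)
    (hY : ∀ μ, DifferentiableAt ℝ (fun y => Y y μ) x) (hf : ContDiffAt ℝ 2 f x) :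
    act X (act Y f) x - act Y (act X f) x = act (bracket X Y) f x := by
  rw [act_act hY hf, act_act hX hf]
  -- The second order parts of XY and YX coincide because partial derivatives of a C² function
  -- commute; only the first order part survives.
  have h : ∑ μ, ∑ ν, X x ν * Y x μ * coordDeriv ν (coordDeriv μ f) x
      = ∑ μ, ∑ ν, Y x ν * X x μ * coordDeriv ν (coordDeriv μ f) x := by
    rw [Finset.sum_comm]
    refine Finset.sum_congr rfl fun μ _ => Finset.sum_congr rfl fun ν _ => ?_
    rw [coordDeriv_comm hf μ ν, mul_comm (X x μ)]
  rw [h]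
  conv_rhs => unfold act
  simp only [bracket, sub_mul, Finset.sum_sub_distrib]
  ring

theorem act_sum_left {ι : Type*} {s : Finset ι} (c : ι → ℂ) (F : ι → VecField)
    (h : ∀ μ, X x μ = ∑ i ∈ s, c i * F i x μ) (f : ScalarField) :
    act X f x = ∑ i ∈ s, c i * act (F i) f x := by
  simp only [act, h, Finset.sum_mul, Finset.mul_sum]
  rw [Finset.sum_comm]
  exact Finset.sum_congr rfl fun _ _ => Finset.sum_congr rfl fun _ _ => by ring

end Calculus

/-! ### Tables of connection and curvature coefficients with one raised index -/

section Tables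

/-- The matrices `(Γ_j)_b^c` as functions of `g = γ` and `h = conj γ`. -/
def conn (g h : Fin 8 → ℂ) : Fin 4 → Matrix (Fin 4) (Fin 4) ℂ :=
  ![!![h 3 + g 2, 0, g 0, h 6;
       0, -h 3 - g 2, g 1, g 5;
       g 5, h 6, h 3 - g 2, 0;
       g 1, g 0, 0, -h 3 + g 2],
    !![-h 2 - g 3, 0, g 1, g 5;
       0, h 2 + g 3, h 0, g 6;
       g 6, g 5, -h 2 + g 3, 0;
       h 0, g 1, 0, h 2 - g 3],
    !![-h 7 + g 7, 0, h 3 - g 2, 0;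
       0, h 7 - g 7, -h 2 + g 3, 0;
       0, 0, -h 7 - g 7, 0;
       -h 2 + g 3, h 3 - g 2, 0, h 7 + g 7],
    !![0, 0, 0, h 4;
       0, 0, 0, g 4;
       g 4, h 4, 0, 0;
       0, 0, 0, 0]]

/-- The matrices `W_b^c_{(jk)}`, indexed by the pairs `(jk)`, as functions of `w` and
`z = conj w`. -/
def weylPair (w z : Fin 5 → ℂ) : Fin 6 → Matrix (Fin 4) (Fin 4) ℂ :=
  ![!![-z 2 - w 2, 0, -w 1, -z 3;
       0, z 2 + w 2, z 1, w 3;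
       w 3, -z 3, -z 2 + w 2, 0;
       z 1, -w 1, 0, z 2 - w 2],
    !![-z 3, 0, 0, -z 4;
       0, z 3, z 2, 0;
       0, -z 4, -z 3, 0;
       z 2, 0, 0, z 3],
    !![w 3, 0, w 2, 0;
       0, -w 3, 0, -w 4;
       -w 4, 0, -w 3, 0;
       0, w 2, 0, w 3],
    !![-w 1, 0, -w 0, 0;
       0, w 1, 0, w 2;
       w 2, 0, w 1, 0;
       0, -w 0, 0, -w 1],
    !![z 1, 0, 0, z 2;
       0, -z 1, -z 0, 0;
       0, z 2, z 1, 0;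
       -z 0, 0, 0, -z 1],
    !![z 2 - w 2, 0, -w 1, z 3;
       0, -z 2 + w 2, -z 1, w 3;
       w 3, z 3, z 2 + w 2, 0;
       -z 1, -w 1, 0, -z 2 - w 2]]

/-- The matrices `W_b^c_{jk}` as functions of `w` and `z = conj w`. -/
def weylMat (w z : Fin 5 → ℂ) (j k : Fin 4) : Matrix (Fin 4) (Fin 4) ℂ :=
  ∑ q, pairSign q j k • weylPair w z q

/-- Replaces sums over the six index pairs by a literal matrix, so that entries of the tables can be
evaluated. -/
theorem sum_pairSign (m : Fin 6 → ℂ) (j k : Fin 4) :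
    ∑ p, pairSign p j k * m p
      = !![0, m 0, -m 1, -m 3; -m 0, 0, -m 2, -m 4; m 1, m 2, 0, m 5; m 3, m 4, -m 5, 0] j k := by
  fin_cases j <;> fin_cases k <;> simp [pairSign, indexPair, Fin.sum_univ_succ]

theorem sum_mul_gLower (v : Fin 4 → ℂ) (k : Fin 4) :
    ∑ c, v c * gLower c k = ![v 1, v 0, -v 3, -v 2] k := by
  fin_cases k <;> simp [gLower, Fin.sum_univ_succ]

theorem Gamma_eq_conn (Φ : (Fin 4 → ℝ) → FieldSpace) (x : Fin 4 → ℝ) (a j k : Fin 4) :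
    Gamma Φ a j k x
      = ∑ c, conn (gammaComp Φ · x) (fun i => conj (gammaComp Φ i x)) a j c * gLower c k := by
  rw [Gamma, sum_pairSign, sum_mul_gLower]
  fin_cases a <;> fin_cases j <;> fin_cases k <;> simp [GammaTable, conn] <;> ring

theorem conn_eq_Gamma (Φ : (Fin 4 → ℝ) → FieldSpace) (x : Fin 4 → ℝ) (a j c : Fin 4) :
    conn (gammaComp Φ · x) (fun i => conj (gammaComp Φ i x)) a j c
      = ∑ d, Gamma Φ a j d x * gUpper d c := by
  simp only [Gamma_eq_conn, Finset.sum_mul]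
  rw [Finset.sum_comm]
  simp only [mul_assoc, ← Finset.mul_sum, ← Matrix.mul_apply, gLower_mul_gUpper, Matrix.one_apply]
  simp

theorem pairSign_swap (p : Fin 6) (j k : Fin 4) : pairSign p k j = -pairSign p j k := by
  revert p j k
  have h (p : Fin 6) : (indexPair p).1 ≠ (indexPair p).2 := by revert p; decide
  intro p j k
  unfold pairSign
  rcases eq_or_ne j k with rfl | hjk
  · have : indexPair p ≠ (j, j) := fun e => h p (by rw [e])
    simp [this]
  · by_cases h₁ : indexPair p = (j, k) <;> by_cases h₂ : indexPair p = (k, j) <;>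
      simp_all

theorem Gamma_swap (Φ : (Fin 4 → ℝ) → FieldSpace) (a j k : Fin 4) (x : Fin 4 → ℝ) :
    Gamma Φ a k j x = -Gamma Φ a j k x := by
  simp [Gamma, pairSign_swap _ j k]

theorem Weyl_eq_weylMat (Φ : (Fin 4 → ℝ) → FieldSpace) (x : Fin 4 → ℝ) (a b j k : Fin 4) :
    Weyl Φ a b j k x
      = ∑ c, weylMat (wComp Φ · x) (fun i => conj (wComp Φ i x)) j k b c * gLower c a := by
  have h (q : Fin 6) : ∑ p, pairSign p a b * WTable Φ x p q
      = ∑ c, weylPair (wComp Φ · x) (fun i => conj (wComp Φ i x)) q b c * gLower c a := by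
    rw [sum_pairSign fun p => WTable Φ x p q, sum_mul_gLower]
    fin_cases q <;> fin_cases a <;> fin_cases b <;> simp [WTable, weylPair] <;> ring
  simp only [Weyl, weylMat, Matrix.sum_apply, Matrix.smul_apply, smul_eq_mul, Finset.sum_mul]
  rw [Finset.sum_comm, Finset.sum_comm (s := (Finset.univ : Finset (Fin 4)))]
  refine Finset.sum_congr rfl fun q _ => ?_
  simp only [mul_assoc, ← Finset.mul_sum, ← h]
  rw [Finset.mul_sum]
  exact Finset.sum_congr rfl fun p _ => by ring

end Tables

/-! ### The frame and its Levi-Civita connection -/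

/-- The standing assumptions on the field `Φ`. -/
structure Admissible (U : Set (Fin 4 → ℝ)) (Φ : (Fin 4 → ℝ) → FieldSpace) : Prop where
  isOpen : IsOpen U
  contDiffOn : ContDiffOn ℝ 2 Φ U
  range : ∀ x ∈ U, Φ x ∈ fieldRange
  star : ConditionStar U Φ
  starStar : ConditionStarStar U Φ

/-- Two matrices agree if they agree after lowering an index. -/
theorem eq_of_lower_eq {v w : Fin 4 → ℂ}
    (h : ∀ k, ∑ c, v c * gLower c k = ∑ c, w c * gLower c k) : v = w := by
  funext c
  -- Lowering exchanges 0 with 1 and 2 with 3 up to sign, so entry c is recovered from the lowered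
  -- entry at its partner.
  have h' := h (![1, 0, 3, 2] c)
  fin_cases c <;> simpa [gLower, Fin.sum_univ_succ] using h'

theorem gLower_comm (a b : Fin 4) : gLower a b = gLower b a := by
  fin_cases a <;> fin_cases b <;> rfl

namespace Admissible

variable {U : Set (Fin 4 → ℝ)} {Φ : (Fin 4 → ℝ) → FieldSpace} (H : Admissible U Φ)
  {x : Fin 4 → ℝ} (hx : x ∈ U)

include H hx

theorem mem_nhds : U ∈ 𝓝 x := H.isOpen.mem_nhds hx

theorem contDiffAt : ContDiffAt ℝ 2 Φ x := H.contDiffOn.contDiffAt (H.mem_nhds hx)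

theorem contDiffAt_eComp (j : Fin 5) : ContDiffAt ℝ 2 (eComp Φ j) x :=
  contDiffAt_pi.1 (H.contDiffAt hx).fst j

theorem contDiffAt_gammaComp (j : Fin 8) : ContDiffAt ℝ 2 (gammaComp Φ j) x :=
  contDiffAt_pi.1 (H.contDiffAt hx).snd.fst j

theorem contDiffAt_wComp (j : Fin 5) : ContDiffAt ℝ 2 (wComp Φ j) x :=
  contDiffAt_pi.1 (H.contDiffAt hx).snd.snd j

omit H hx in
theorem contDiffAt_conj {f : ScalarField} (hf : ContDiffAt ℝ 2 f x) : ContDiffAt ℝ 2 (conj f) x :=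
  Complex.conjCLE.contDiff.contDiffAt.comp x hf

theorem contDiffAt_frame (a μ : Fin 4) : ContDiffAt ℝ 2 (fun y => frame Φ a y μ) x := by
  have he := H.contDiffAt_eComp hx
  have hc (j) := contDiffAt_conj (he j)
  fin_cases a <;> fin_cases μ <;> first | exact he _ | exact hc _ | exact contDiffAt_const

theorem differentiableAt_frame (a μ : Fin 4) :
    DifferentiableAt ℝ (fun y => frame Φ a y μ) x :=
  (H.contDiffAt_frame hx a μ).differentiableAt (by norm_num)

theorem conj_eComp {j : Fin 5} (hj : 2 ≤ j) : conj (eComp Φ j x) = eComp Φ j x := by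
  obtain ⟨h₃, h₄, h₅, -, -⟩ := H.range x hx
  rw [Complex.conj_eq_iff_im]
  fin_cases j
  · exact absurd hj (by decide)
  · exact absurd hj (by decide)
  · exact h₃
  · exact h₄
  · exact h₅

theorem conj_gammaComp_one : conj (gammaComp Φ 1 x) = gammaComp Φ 1 x :=
  Complex.conj_eq_iff_im.2 (H.range x hx).2.2.2.1

theorem conj_gammaComp_five : conj (gammaComp Φ 5 x) = gammaComp Φ 5 x :=
  Complex.conj_eq_iff_im.2 (H.range x hx).2.2.2.2

/-- The determinant is -2i · Im(e₁ē₂) · e₃, so (⋆) and (⋆⋆) together say that the frame is a basis.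
-/
theorem isUnit_det : IsUnit (frameMatrix Φ x).det := by
  have hdet : (frameMatrix Φ x).det
      = -(eComp Φ 0 x * conj (eComp Φ 1 x) - eComp Φ 1 x * conj (eComp Φ 0 x)) * eComp Φ 2 x := by
    simp [frameMatrix, Matrix.det_succ_row_zero, Fin.sum_univ_succ, Fin.succAbove]
    ring
  rw [isUnit_iff_ne_zero, hdet]
  refine mul_ne_zero (neg_ne_zero.2 fun h => H.starStar x hx ?_) fun h => ?_
  · have := congrArg Complex.im h
    simp only [Complex.sub_im, Complex.mul_im, Complex.conj_re, Complex.conj_im,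
      Complex.zero_im] at this ⊢
    linarith
  · have := H.star x hx
    simp [h] at this

/-- Uniqueness of the expansion in a basis. Frame coefficients are thereby verified instead of
computed, and the inverse matrix is never written out. -/
theorem coeff_eq_iff {X : VecField} {c : Fin 4 → ℂ} :
    coeff Φ X x = c ↔ ∀ μ, X x μ = ∑ a, c a * frame Φ a x μ := by
  have h := H.isUnit_det hx
  have e : (∀ μ, X x μ = ∑ a, c a * frame Φ a x μ) ↔ X x = c ᵥ* frameMatrix Φ x :=
    funext_iff.symm
  rw [e, coeff]
  constructor
  · rintro rfl
    rw [Matrix.vecMul_vecMul, Matrix.nonsing_inv_mul _ h, Matrix.vecMul_one]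
  · intro hX
    rw [hX, Matrix.vecMul_vecMul, Matrix.mul_nonsing_inv _ h, Matrix.vecMul_one]

theorem eq_sum_coeff (X : VecField) (μ : Fin 4) :
    X x μ = ∑ a, coeff Φ X x a * frame Φ a x μ :=
  (H.coeff_eq_iff hx).1 rfl μ

theorem coeff_frame (a : Fin 4) : coeff Φ (frame Φ a) x = Pi.single a 1 :=
  (H.coeff_eq_iff hx).2 fun μ => by simp [Pi.single_apply]

theorem metric_frame_left (k : Fin 4) (X : VecField) :
    metric Φ (frame Φ k) X x = ∑ c, coeff Φ X x c * gLower c k := by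
  simp [metric, H.coeff_frame hx, Pi.single_apply, gLower_comm k, mul_comm]

theorem metric_frame_right (k : Fin 4) (X : VecField) :
    metric Φ X (frame Φ k) x = ∑ c, coeff Φ X x c * gLower c k := by
  simp [metric, H.coeff_frame hx, Pi.single_apply, mul_comm]

omit H hx in
theorem coeff_bracket_swap (X Y : VecField) (c : Fin 4) :
    coeff Φ (bracket X Y) x c = -coeff Φ (bracket Y X) x c := by
  have : bracket X Y x = -bracket Y X x := by
    funext μ
    simp [bracket]
  simp [coeff, this, Matrix.neg_vecMul]

/-- The Levi-Civita connection has the coefficients `Γ` if and only if the torsion of `Γ`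
vanishes. -/
theorem koszul_eq_Gamma_iff :
    (∀ a j k, koszul Φ a j k x = Gamma Φ a j k x) ↔
      ∀ a b, coeff Φ (bracket (frame Φ a) (frame Φ b)) x
        = fun c => conn (gammaComp Φ · x) (fun i => conj (gammaComp Φ i x)) a b c
          - conn (gammaComp Φ · x) (fun i => conj (gammaComp Φ i x)) b a c := by
  have swap (a b k : Fin 4) :
      ∑ c, coeff Φ (bracket (frame Φ a) (frame Φ b)) x c * gLower c k
        = -∑ c, coeff Φ (bracket (frame Φ b) (frame Φ a)) x c * gLower c k := by
    simp [coeff_bracket_swap (frame Φ a) (frame Φ b)]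
  have hk (a j k : Fin 4) : koszul Φ a j k x = (1 / 2 : ℂ) *
      (-(∑ c, coeff Φ (bracket (frame Φ j) (frame Φ k)) x c * gLower c a)
        + ∑ c, coeff Φ (bracket (frame Φ a) (frame Φ j)) x c * gLower c k
        + ∑ c, coeff Φ (bracket (frame Φ k) (frame Φ a)) x c * gLower c j) := by
    simp only [koszul, H.metric_frame_left hx]
  constructor
  · intro h a b
    refine eq_of_lower_eq fun k => ?_
    simp only [sub_mul, Finset.sum_sub_distrib, ← Gamma_eq_conn]
    -- The part of the Koszul formula antisymmetric in its first two slots is the lowered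
    -- commutator.
    have h₁ := h a b k
    have h₂ := h b a k
    rw [hk] at h₁ h₂
    linear_combination h₁ - h₂ + (1 / 2 : ℂ) * swap k b a - (1 / 2 : ℂ) * swap a k b
      + (1 / 2 : ℂ) * swap a b k
  · intro h a j k
    rw [hk]
    simp only [h, sub_mul, Finset.sum_sub_distrib, ← Gamma_eq_conn]
    -- Metric compatibility, i.e. the skewness of Γ in its last two indices, collapses the six terms
    -- of the Koszul sum to Γ_{ajk}.
    rw [Gamma_swap Φ j a k, Gamma_swap Φ k a j, Gamma_swap Φ a j k]
    ring

end Admissible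

/-! ### The Riemann tensor in terms of the connection coefficients -/

/-- With the conjugates as a separate argument the table is complex linear, although it is only real
linear in γ. Frame derivatives therefore pass through it entry by entry. -/
theorem conn_smul_add (r : ℂ) (g h g' h' : Fin 8 → ℂ) (j : Fin 4) :
    conn (r • g + g') (r • h + h') j = r • conn g h j + conn g' h' j := by
  fin_cases j <;> simp [conn] <;> ring_nf <;> simp

theorem weylPair_smul_add (r : ℂ) (w z w' z' : Fin 5 → ℂ) (q : Fin 6) :
    weylPair (r • w + w') (r • z + z') q = r • weylPair w z q + weylPair w' z' q := by
  fin_cases q <;> simp [weylPair] <;> ring_nf <;> simp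

theorem weylMat_smul_add (r : ℂ) (w z w' z' : Fin 5 → ℂ) (j k : Fin 4) :
    weylMat (r • w + w') (r • z + z') j k = r • weylMat w z j k + weylMat w' z' j k := by
  simp only [weylMat, weylPair_smul_add, smul_add, Finset.sum_add_distrib, Finset.smul_sum,
    smul_comm r]

/-- A map preserving linear combinations, as a linear map. -/
def linearOfSmulAdd {V : Type*} [AddCommGroup V] [Module ℂ V] (f : V → ℂ)
    (hf : ∀ (r : ℂ) (v v' : V), f (r • v + v') = r • f v + f v') : V →ₗ[ℂ] ℂ where
  toFun := f
  map_add' v v' := by simpa using hf 1 v v'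
  map_smul' r v := by
    have h₀ : f 0 = 0 := by simpa using hf 1 0 0
    simpa [h₀] using hf r v 0

/-- An entry of `conn` as a linear form. -/
def connForm (j b c : Fin 4) : (Fin 8 ⊕ Fin 8 → ℂ) →ₗ[ℂ] ℂ :=
  linearOfSmulAdd (fun v => conn (v ∘ Sum.inl) (v ∘ Sum.inr) j b c) fun r _ _ =>
    congrFun (congrFun (conn_smul_add r _ _ _ _ j) b) c

/-- An entry of `weylMat` as a linear form. -/
def weylForm (j k b c : Fin 4) : (Fin 5 ⊕ Fin 5 → ℂ) →ₗ[ℂ] ℂ :=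
  linearOfSmulAdd (fun v => weylMat (v ∘ Sum.inl) (v ∘ Sum.inr) j k b c) fun r _ _ =>
    congrFun (congrFun (weylMat_smul_add r _ _ _ _ j k) b) c

/-- The values of `γ` at `x`. -/
def gam (Φ : (Fin 4 → ℝ) → FieldSpace) (x : Fin 4 → ℝ) : Fin 8 → ℂ := (gammaComp Φ · x)

/-- The values of `conj γ` at `x`. -/
def gamBar (Φ : (Fin 4 → ℝ) → FieldSpace) (x : Fin 4 → ℝ) : Fin 8 → ℂ :=
  fun i => conj (gammaComp Φ i x)

/-- The frame derivatives of `γ` at `x`. -/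
def dgam (Φ : (Fin 4 → ℝ) → FieldSpace) (x : Fin 4 → ℝ) (a : Fin 4) : Fin 8 → ℂ :=
  fun i => act (frame Φ a) (gammaComp Φ i) x

/-- The frame derivatives of `conj γ` at `x`. -/
def dgamBar (Φ : (Fin 4 → ℝ) → FieldSpace) (x : Fin 4 → ℝ) (a : Fin 4) : Fin 8 → ℂ :=
  fun i => act (frame Φ a) (conj (gammaComp Φ i)) x

/-- The values of `w` at `x`. -/
def wey (Φ : (Fin 4 → ℝ) → FieldSpace) (x : Fin 4 → ℝ) : Fin 5 → ℂ := (wComp Φ · x)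

/-- The values of `conj w` at `x`. -/
def weyBar (Φ : (Fin 4 → ℝ) → FieldSpace) (x : Fin 4 → ℝ) : Fin 5 → ℂ :=
  fun i => conj (wComp Φ i x)

/-- The frame derivatives of `w` at `x`. -/
def dwey (Φ : (Fin 4 → ℝ) → FieldSpace) (x : Fin 4 → ℝ) (a : Fin 4) : Fin 5 → ℂ :=
  fun i => act (frame Φ a) (wComp Φ i) x

/-- The frame derivatives of `conj w` at `x`. -/
def dweyBar (Φ : (Fin 4 → ℝ) → FieldSpace) (x : Fin 4 → ℝ) (a : Fin 4) : Fin 5 → ℂ :=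
  fun i => act (frame Φ a) (conj (wComp Φ i)) x

/-- The connection matrices at `x`. -/
def cmat (Φ : (Fin 4 → ℝ) → FieldSpace) (x : Fin 4 → ℝ) : Fin 4 → Matrix (Fin 4) (Fin 4) ℂ :=
  conn (gam Φ x) (gamBar Φ x)

/-- The frame derivatives of the connection matrices at `x`. -/
def dcmat (Φ : (Fin 4 → ℝ) → FieldSpace) (x : Fin 4 → ℝ) (a : Fin 4) :
    Fin 4 → Matrix (Fin 4) (Fin 4) ℂ :=
  conn (dgam Φ x a) (dgamBar Φ x a)

/-- The curvature of a torsion free connection with connection matrices `M` and frame derivatives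
`dM`. -/
def curvature (M : Fin 4 → Matrix (Fin 4) (Fin 4) ℂ) (dM : Fin 4 → Fin 4 → Matrix (Fin 4) (Fin 4) ℂ)
    (j k : Fin 4) : Matrix (Fin 4) (Fin 4) ℂ :=
  dM j k - dM k j + M k * M j - M j * M k - ∑ d, (M j k d - M k j d) • M d

namespace Admissible

variable {U : Set (Fin 4 → ℝ)} {Φ : (Fin 4 → ℝ) → FieldSpace} (H : Admissible U Φ)
  {x : Fin 4 → ℝ} (hx : x ∈ U)

include H hx

theorem contDiffAt_cmat (j b c : Fin 4) : ContDiffAt ℝ 2 (fun y => cmat Φ y j b c) x := by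
  have h (y) : cmat Φ y j b c
      = connForm j b c (Sum.elim (gammaComp Φ · y) (fun i => conj (gammaComp Φ i) y)) := rfl
  simp only [h]
  refine ((connForm j b c).restrictScalars ℝ).toContinuousLinearMap.contDiff.contDiffAt.comp x ?_
  refine contDiffAt_pi.2 fun i => ?_
  rcases i with i | i
  · exact H.contDiffAt_gammaComp hx i
  · exact contDiffAt_conj (H.contDiffAt_gammaComp hx i)

theorem contDiffAt_weylMat (j k b c : Fin 4) :
    ContDiffAt ℝ 2 (fun y => weylMat (wey Φ y) (weyBar Φ y) j k b c) x := by
  have h (y) : weylMat (wey Φ y) (weyBar Φ y) j k b c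
      = weylForm j k b c (Sum.elim (wComp Φ · y) (fun i => conj (wComp Φ i) y)) := rfl
  simp only [h]
  refine ((weylForm j k b c).restrictScalars ℝ).toContinuousLinearMap.contDiff.contDiffAt.comp x ?_
  refine contDiffAt_pi.2 fun i => ?_
  rcases i with i | i
  · exact H.contDiffAt_wComp hx i
  · exact contDiffAt_conj (H.contDiffAt_wComp hx i)

theorem act_cmat (a j b c : Fin 4) :
    act (frame Φ a) (fun y => cmat Φ y j b c) x = dcmat Φ x a j b c := by
  have h := act_linearMap (connForm j b c)
    (f := Sum.elim (gammaComp Φ) (fun i => conj (gammaComp Φ i))) (x := x) (fun i => by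
      rcases i with i | i
      · exact (H.contDiffAt_gammaComp hx i).differentiableAt (by norm_num)
      · exact (contDiffAt_conj (H.contDiffAt_gammaComp hx i)).differentiableAt (by norm_num))
    (frame Φ a)
  exact h

theorem act_weylMat (a j k b c : Fin 4) :
    act (frame Φ a) (fun y => weylMat (wey Φ y) (weyBar Φ y) j k b c) x
      = weylMat (dwey Φ x a) (dweyBar Φ x a) j k b c := by
  have h := act_linearMap (weylForm j k b c)
    (f := Sum.elim (wComp Φ) (fun i => conj (wComp Φ i))) (x := x) (fun i => by
      rcases i with i | i
      · exact (H.contDiffAt_wComp hx i).differentiableAt (by norm_num)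
      · exact (contDiffAt_conj (H.contDiffAt_wComp hx i)).differentiableAt (by norm_num))
    (frame Φ a)
  exact h

variable (hconn : ∀ y ∈ U, ∀ a j k, koszul Φ a j k y = Gamma Φ a j k y)

include hconn

omit H in
theorem sum_koszul_gUpper (a b c : Fin 4) :
    ∑ d, koszul Φ a b d x * gUpper d c = cmat Φ x a b c := by
  simp only [hconn x hx]
  exact (conn_eq_Gamma Φ x a b c).symm

theorem coeff_covDeriv (X Y : VecField) :
    coeff Φ (covDeriv Φ X Y) x = fun c => act X (fun y => coeff Φ Y y c) x
      + ∑ a, ∑ b, coeff Φ X x a * coeff Φ Y x b * cmat Φ x a b c := by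
  refine (H.coeff_eq_iff hx).2 fun μ => ?_
  simp only [covDeriv, ← sum_koszul_gUpper hx hconn, Finset.mul_sum, mul_assoc]

theorem coeff_covDeriv_frame (X : VecField) (b : Fin 4) :
    coeff Φ (covDeriv Φ X (frame Φ b)) x
      = fun c => ∑ a, coeff Φ X x a * cmat Φ x a b c := by
  rw [H.coeff_covDeriv hx hconn]
  funext c
  -- A frame field has constant coefficients near x, so only the connection term remains.
  have h : (fun y => coeff Φ (frame Φ b) y c) =ᶠ[𝓝 x] fun _ => (Pi.single b 1 : Fin 4 → ℂ) c :=
    eventually_of_mem (H.mem_nhds hx) fun y hy => by simp only [H.coeff_frame hy]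
  rw [act_congr h, act_const, zero_add]
  simp [H.coeff_frame hx, Pi.single_apply]

/-- Matrix rows are indexed by the frame field being differentiated, so iterating ∇ reverses the
order of the product: first Γ_k, then Γ_j gives the product `cmat Φ x k * cmat Φ x j`. The
connection condition is needed near x, since the inner coefficients are differentiated again. -/
theorem coeff_covDeriv_covDeriv (j k b : Fin 4) :
    coeff Φ (covDeriv Φ (frame Φ j) (covDeriv Φ (frame Φ k) (frame Φ b))) x
      = fun c => dcmat Φ x j k b c + (cmat Φ x k * cmat Φ x j) b c := by
  have h (y) (hy : y ∈ U) : coeff Φ (covDeriv Φ (frame Φ k) (frame Φ b)) y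
      = fun c => cmat Φ y k b c := by
    rw [H.coeff_covDeriv_frame hy hconn]
    simp [H.coeff_frame hy, Pi.single_apply]
  rw [H.coeff_covDeriv hx hconn, h x hx]
  funext c
  have h' : (fun y => coeff Φ (covDeriv Φ (frame Φ k) (frame Φ b)) y c)
      =ᶠ[𝓝 x] fun y => cmat Φ y k b c :=
    eventually_of_mem (H.mem_nhds hx) fun y hy => by simp only [h y hy]
  rw [act_congr h', H.act_cmat hx]
  simp [H.coeff_frame hx, Pi.single_apply, Matrix.mul_apply]

theorem coeff_bracket (j k : Fin 4) :
    coeff Φ (bracket (frame Φ j) (frame Φ k)) x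
      = fun c => cmat Φ x j k c - cmat Φ x k j c :=
  (H.koszul_eq_Gamma_iff hx).1 (hconn x hx) j k

theorem riemann_eq (a b j k : Fin 4) :
    riemann Φ a b j k x
      = ∑ c, curvature (cmat Φ x) (dcmat Φ x) j k b c * gLower c a := by
  rw [riemann, H.metric_frame_right hx]
  refine Finset.sum_congr rfl fun c _ => congrArg (· * gLower c a) ?_
  have h (X Y : VecField) : coeff Φ (X - Y) x = coeff Φ X x - coeff Φ Y x :=
    Matrix.sub_vecMul ..
  rw [h, h, H.coeff_covDeriv_covDeriv hx hconn, H.coeff_covDeriv_covDeriv hx hconn,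
    H.coeff_covDeriv_frame hx hconn, H.coeff_bracket hx hconn]
  simp only [curvature, Pi.sub_apply, Matrix.sub_apply, Matrix.add_apply, Matrix.sum_apply,
    Matrix.smul_apply, smul_eq_mul]
  ring

/-- The curvature condition of a vacuum field, as a matrix equation. -/
theorem riemann_eq_Weyl_iff :
    (∀ a b j k, riemann Φ a b j k x = Weyl Φ a b j k x) ↔
      ∀ j k, curvature (cmat Φ x) (dcmat Φ x) j k = weylMat (wey Φ x) (weyBar Φ x) j k := by
  simp only [H.riemann_eq hx hconn, Weyl_eq_weylMat]
  constructor
  · intro h j k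
    funext b
    exact eq_of_lower_eq fun a => h a b j k
  · intro h a b j k
    rw [h]
    rfl

end Admissible

/-! ### The structure equations for the connection coefficients -/

/-- The structure equations for `g = γ`, with `h = conj γ`: the derivatives of `g` along the frame are
`D, Db, N, L`, those of `h` are `D', Db', N', L'`. -/
structure ConnEqs (g h : Fin 8 → ℂ) (w : Fin 5 → ℂ) (D Db N L D' Db' : Fin 8 → ℂ) : Prop where
  L_γ₁ : L 0 = -w 0 - 2 * g 0 * g 1
  L_γ₂ : L 1 = -g 0 * h 0 - g 1 * g 1
  L_γ₃ : L 2 = -w 1 - g 1 * g 2 + g 0 * g 3 - g 0 * g 4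
  L_γ₄ : L 3 = g 2 * h 0 - g 1 * g 3 + g 1 * g 4
  N_γ₅ : N 4 = w 3 + g 4 * h 7 - g 5 * h 2 + g 3 * g 5 - g 4 * g 5 + g 6 * h 3 - g 6 * h 4
      - g 2 * g 6 - g 4 * g 7
  N_γ₆ : N 5 = -g 5 * h 7 - g 5 * g 5 - g 6 * h 6 - g 5 * g 7
  N_γ₇ : N 6 = -w 4 + g 6 * h 7 - 2 * g 5 * g 6 - 3 * g 6 * g 7
  L_γ₈ : L 7 = w 2 + g 2 * h 2 + g 3 * h 3 - g 3 * h 4 - 2 * g 2 * g 3 - g 4 * h 3 + 2 * g 2 * g 4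
  u₁ : D 1 - Db 0 = -w 1 + g 0 * h 2 - g 1 * h 3 + g 1 * g 2 + 3 * g 0 * g 3
  u₂ : D 3 + Db 2 = w 2 - g 2 * h 2 - g 3 * h 3 - 2 * g 2 * g 3 + g 1 * g 5 - g 0 * g 6
  u₃ : -Db' 3 + Db 2 + N 1 = w 2 + g 1 * h 7 + 2 * g 3 * h 3 - 2 * g 2 * g 3 - g 1 * g 5
      - g 0 * g 6 + g 1 * g 7
  u₄ : D' 3 - D 2 - N 0 = g 0 * h 7 + g 1 * h 6 + 2 * g 2 * h 3 - 2 * g 2 * g 2 + g 0 * g 5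
      - 3 * g 0 * g 7
  u₅ : Db 4 - L 6 = g 4 * h 2 + g 3 * g 4 - g 4 * g 4 + g 5 * h 0 + g 1 * g 6
  u₆ : -D 4 + L 5 = w 2 + g 4 * h 3 + g 4 * h 4 + g 2 * g 4 - g 1 * g 5 - g 0 * g 6
  u₇ : D 7 - N 2 = g 2 * h 7 - g 3 * h 6 - g 5 * h 3 + 2 * g 2 * g 5 - g 2 * g 7
  u₈ : Db 7 + N 3 = -w 3 + g 3 * h 7 - g 3 * g 5 - g 6 * h 3 + 2 * g 2 * g 6 - g 3 * g 7
  u₉ : D 6 - Db 5 = w 3 + g 5 * h 2 - g 3 * g 5 - g 6 * h 3 - 3 * g 2 * g 6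

/-! ### Symmetries of the curvature and Weyl matrices -/

theorem weylMat_apply (w z : Fin 5 → ℂ) (j k b c : Fin 4) :
    weylMat w z j k b c
      = !![0, weylPair w z 0 b c, -weylPair w z 1 b c, -weylPair w z 3 b c;
          -weylPair w z 0 b c, 0, -weylPair w z 2 b c, -weylPair w z 4 b c;
          weylPair w z 1 b c, weylPair w z 2 b c, 0, weylPair w z 5 b c;
          weylPair w z 3 b c, weylPair w z 4 b c, -weylPair w z 5 b c, 0] j k := by
  rw [← sum_pairSign fun q => weylPair w z q b c]
  simp [weylMat, Matrix.sum_apply]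

theorem weylMat_swap (w z : Fin 5 → ℂ) (j k : Fin 4) : weylMat w z k j = -weylMat w z j k := by
  simp [weylMat, pairSign_swap _ j k]

theorem curvature_swap (M : Fin 4 → Matrix (Fin 4) (Fin 4) ℂ)
    (dM : Fin 4 → Fin 4 → Matrix (Fin 4) (Fin 4) ℂ) (j k : Fin 4) :
    curvature M dM k j = -curvature M dM j k := by
  have h : ∑ d, (M k j d - M j k d) • M d = -∑ d, (M j k d - M k j d) • M d := by
    rw [← Finset.sum_neg_distrib]
    exact Finset.sum_congr rfl fun d _ => by rw [← neg_smul, neg_sub]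
  simp only [curvature, h]
  abel

/-- Matrices that are antisymmetric after lowering an index. -/
def IsSkew (X : Matrix (Fin 4) (Fin 4) ℂ) : Prop := X * gLower + gLower * Xᵀ = 0

namespace IsSkew

variable {X Y : Matrix (Fin 4) (Fin 4) ℂ}

theorem add (hX : IsSkew X) (hY : IsSkew Y) : IsSkew (X + Y) := by
  have h : (X + Y) * gLower + gLower * (X + Y)ᵀ
      = (X * gLower + gLower * Xᵀ) + (Y * gLower + gLower * Yᵀ) := by
    rw [Matrix.transpose_add]
    noncomm_ring
  rw [IsSkew, h, hX, hY, add_zero]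

theorem smul (hX : IsSkew X) (r : ℂ) : IsSkew (r • X) := by
  have h : (r • X) * gLower + gLower * (r • X)ᵀ = r • (X * gLower + gLower * Xᵀ) := by
    simp [Matrix.transpose_smul, smul_add]
  rw [IsSkew, h, hX, smul_zero]

theorem sub (hX : IsSkew X) (hY : IsSkew Y) : IsSkew (X - Y) := by
  simpa [sub_eq_add_neg] using hX.add (hY.smul (-1))

theorem sum {ι : Type*} {s : Finset ι} {f : ι → Matrix (Fin 4) (Fin 4) ℂ}
    (hf : ∀ i ∈ s, IsSkew (f i)) : IsSkew (∑ i ∈ s, f i) :=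
  Finset.sum_induction f IsSkew (fun _ _ => add) (by simp [IsSkew]) hf

theorem commutator (hX : IsSkew X) (hY : IsSkew Y) : IsSkew (X * Y - Y * X) := by
  have h : (X * Y - Y * X) * gLower + gLower * (X * Y - Y * X)ᵀ
      = X * (Y * gLower + gLower * Yᵀ) - Y * (X * gLower + gLower * Xᵀ)
        - (X * gLower + gLower * Xᵀ) * Yᵀ + (Y * gLower + gLower * Yᵀ) * Xᵀ := by
    rw [Matrix.transpose_sub, Matrix.transpose_mul, Matrix.transpose_mul]
    noncomm_ring
  rw [IsSkew, h, hX, hY]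
  simp

end IsSkew

theorem isSkew_iff {X : Matrix (Fin 4) (Fin 4) ℂ} :
    IsSkew X ↔ X 0 1 = 0 ∧ X 1 0 = 0 ∧ X 2 3 = 0 ∧ X 3 2 = 0 ∧ X 1 1 = -X 0 0 ∧ X 3 3 = -X 2 2 ∧
      X 0 3 = X 2 1 ∧ X 0 2 = X 3 1 ∧ X 1 3 = X 2 0 ∧ X 1 2 = X 3 0 := by
  rw [IsSkew, ← Matrix.ext_iff]
  simp [Fin.forall_fin_succ, gLower, Fin.sum_univ_succ, Matrix.mul_apply, Matrix.vecMul, dotProduct]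
  grind

/-- The Lie algebra so(g) has dimension six. Up to sign, the six entries compared are the lowered
components at the pairs (12), (31), (32), (41), (42), (34), in this order. -/
theorem IsSkew.ext {X Y : Matrix (Fin 4) (Fin 4) ℂ} (hX : IsSkew X) (hY : IsSkew Y)
    (h₁₁ : X 1 1 = Y 1 1) (h₀₃ : X 0 3 = Y 0 3) (h₁₃ : X 1 3 = Y 1 3) (h₀₂ : X 0 2 = Y 0 2)
    (h₁₂ : X 1 2 = Y 1 2) (h₃₃ : X 3 3 = Y 3 3) : X = Y := by
  rw [isSkew_iff] at hX hY
  rw [← Matrix.ext_iff]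
  simp [Fin.forall_fin_succ]
  grind

theorem isSkew_conn (g h : Fin 8 → ℂ) (j : Fin 4) : IsSkew (conn g h j) := by
  rw [isSkew_iff]
  fin_cases j <;> simp [conn] <;> constructor <;> ring

theorem isSkew_weylPair (w z : Fin 5 → ℂ) (q : Fin 6) : IsSkew (weylPair w z q) := by
  rw [isSkew_iff]
  fin_cases q <;> simp [weylPair] <;> constructor <;> ring

theorem isSkew_weylMat (w z : Fin 5 → ℂ) (j k : Fin 4) : IsSkew (weylMat w z j k) :=
  IsSkew.sum fun q _ => (isSkew_weylPair w z q).smul _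

/-- The curvature of a metric connection takes values in so(g), because so(g) is a linear space
closed under commutators. -/
theorem isSkew_curvature {M : Fin 4 → Matrix (Fin 4) (Fin 4) ℂ}
    {dM : Fin 4 → Fin 4 → Matrix (Fin 4) (Fin 4) ℂ} (hM : ∀ j, IsSkew (M j))
    (hdM : ∀ j k, IsSkew (dM j k)) (j k : Fin 4) : IsSkew (curvature M dM j k) := by
  have h : curvature M dM j k
      = dM j k - dM k j + (M k * M j - M j * M k) - ∑ d, (M j k d - M k j d) • M d := by
    rw [curvature]
    abel
  rw [h]
  exact (((hdM j k).sub (hdM k j)).add ((hM k).commutator (hM j))).sub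
    (IsSkew.sum fun d _ => (hM d).smul _)

/-- Supplies the second half of the curvature equations: the system lists only one equation from
each conjugate pair. -/
theorem ConnEqs.conj {g h : Fin 8 → ℂ} {w : Fin 5 → ℂ} {D Db N L D' Db' : Fin 8 → ℂ}
    (E : ConnEqs g h w D Db N L D' Db') :
    ConnEqs (conj g) (conj h) (conj w) (conj D) (conj Db) (conj N) (conj L) (conj D')
      (conj Db') := by
  have key {a b : ℂ} (h : a = b) : starRingEnd ℂ a = starRingEnd ℂ b := congrArg _ h
  constructor
  · simpa [map_ofNat] using key E.L_γ₁
  · simpa [map_ofNat] using key E.L_γ₂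
  · simpa [map_ofNat] using key E.L_γ₃
  · simpa [map_ofNat] using key E.L_γ₄
  · simpa [map_ofNat] using key E.N_γ₅
  · simpa [map_ofNat] using key E.N_γ₆
  · simpa [map_ofNat] using key E.N_γ₇
  · simpa [map_ofNat] using key E.L_γ₈
  · simpa [map_ofNat] using key E.u₁
  · simpa [map_ofNat] using key E.u₂
  · simpa [map_ofNat] using key E.u₃
  · simpa [map_ofNat] using key E.u₄
  · simpa [map_ofNat] using key E.u₅
  · simpa [map_ofNat] using key E.u₆
  · simpa [map_ofNat] using key E.u₇
  · simpa [map_ofNat] using key E.u₈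
  · simpa [map_ofNat] using key E.u₉

theorem forall_of_pairs {P : Fin 4 → Fin 4 → Prop} (hdiag : ∀ j, P j j)
    (hswap : ∀ j k, P j k → P k j) (h₀₁ : P 0 1) (h₂₀ : P 2 0) (h₂₁ : P 2 1) (h₃₀ : P 3 0)
    (h₃₁ : P 3 1) (h₂₃ : P 2 3) (j k : Fin 4) : P j k := by
  fin_cases j <;> fin_cases k <;> first | exact hdiag _ | assumption | exact hswap _ _ ‹_›

/-! ### The curvature condition as seventeen equations and their conjugates -/

section Algebra

variable {g h : Fin 8 → ℂ} {w z : Fin 5 → ℂ} {dg dh : Fin 4 → Fin 8 → ℂ}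
  (h₁ : h 1 = g 1) (h₅ : h 5 = g 5) (d₁ : ∀ a, dh a 1 = dg a 1) (d₅ : ∀ a, dh a 5 = dg a 5)

include h₁ h₅ d₁ d₅

-- By skewness six entries have to be checked for each of six pairs (jk). Each is a signed sum of at
-- most three of the equations `a1`, …, `a17` of `E` and their conjugates `b1`, …, `b17`.
set_option linter.unusedSimpArgs false in
set_option maxHeartbeats 1000000 in
theorem curvature_eq_of_connEqs
    (E : ConnEqs g h w (dg 0) (dg 1) (dg 2) (dg 3) (dh 0) (dh 1))
    (E' : ConnEqs h g z (dh 1) (dh 0) (dh 2) (dh 3) (dg 1) (dg 0)) (j k : Fin 4) :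
    curvature (conn g h) (fun a => conn (dg a) (dh a)) j k = weylMat w z j k := by
  have hext (j k) := (isSkew_curvature (isSkew_conn g h)
    (fun a => isSkew_conn (dg a) (dh a)) j k).ext (isSkew_weylMat w z j k)
  have hswap (j k)
      (e : curvature (conn g h) (fun a => conn (dg a) (dh a)) j k = weylMat w z j k) :
      curvature (conn g h) (fun a => conn (dg a) (dh a)) k j = weylMat w z k j := by
    rw [curvature_swap, weylMat_swap, e]
  obtain ⟨a1, a2, a3, a4, a5, a6, a7, a8, a9, a10, a11, a12, a13, a14, a15, a16, a17⟩ := E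
  obtain ⟨b1, b2, b3, b4, b5, b6, b7, b8, b9, b10, b11, b12, b13, b14, b15, b16, b17⟩ := E'
  -- Reality of γ₂ and γ₆ (indices 1 and 5 from zero) lets both systems speak about the same
  -- unknowns.
  simp only [h₁, h₅, d₁, d₅] at b1 b2 b3 b4 b5 b6 b7 b8 b9 b10 b11 b12 b13 b14 b15 b16 b17
  have c01 : curvature (conn g h) (fun a => conn (dg a) (dh a)) 0 1 = weylMat w z 0 1 := by
    apply hext <;> simp only [curvature, weylMat_apply, Fin.sum_univ_four, Matrix.mul_apply,
      Matrix.add_apply, Matrix.sub_apply, Matrix.smul_apply, Matrix.sum_apply, smul_eq_mul, conn,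
      weylPair, Matrix.cons_val, Matrix.of_apply, h₁, h₅, d₁, d₅]
    · linear_combination a10 + b10
    · linear_combination -b17
    · linear_combination a17
    · linear_combination a9
    · linear_combination -b9
    · linear_combination -a10 + b10
  have c20 : curvature (conn g h) (fun a => conn (dg a) (dh a)) 2 0 = weylMat w z 2 0 := by
    apply hext <;> simp only [curvature, weylMat_apply, Fin.sum_univ_four, Matrix.mul_apply,
      Matrix.add_apply, Matrix.sub_apply, Matrix.smul_apply, Matrix.sum_apply, smul_eq_mul, conn,
      weylPair, Matrix.cons_val, Matrix.of_apply, h₁, h₅, d₁, d₅]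
    · linear_combination a15 - b16
    · linear_combination b7
    · linear_combination a6
    · linear_combination -a12
    · linear_combination -a10 + b10 + a11
    · linear_combination -a15 - b16
  have c21 : curvature (conn g h) (fun a => conn (dg a) (dh a)) 2 1 = weylMat w z 2 1 := by
    apply hext <;> simp only [curvature, weylMat_apply, Fin.sum_univ_four, Matrix.mul_apply,
      Matrix.add_apply, Matrix.sub_apply, Matrix.smul_apply, Matrix.sum_apply, smul_eq_mul, conn,
      weylPair, Matrix.cons_val, Matrix.of_apply, h₁, h₅, d₁, d₅]
    · linear_combination -b15 + a16
    · linear_combination a6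
    · linear_combination a7
    · linear_combination a11
    · linear_combination -b12
    · linear_combination -b15 - a16
  have c30 : curvature (conn g h) (fun a => conn (dg a) (dh a)) 3 0 = weylMat w z 3 0 := by
    apply hext <;> simp only [curvature, weylMat_apply, Fin.sum_univ_four, Matrix.mul_apply,
      Matrix.add_apply, Matrix.sub_apply, Matrix.smul_apply, Matrix.sum_apply, smul_eq_mul, conn,
      weylPair, Matrix.cons_val, Matrix.of_apply, h₁, h₅, d₁, d₅]
    · linear_combination -a3 - b4
    · linear_combination -b13
    · linear_combination a14
    · linear_combination a1
    · linear_combination a2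
    · linear_combination a3 - b4
  have c31 : curvature (conn g h) (fun a => conn (dg a) (dh a)) 3 1 = weylMat w z 3 1 := by
    apply hext <;> simp only [curvature, weylMat_apply, Fin.sum_univ_four, Matrix.mul_apply,
      Matrix.add_apply, Matrix.sub_apply, Matrix.smul_apply, Matrix.sum_apply, smul_eq_mul, conn,
      weylPair, Matrix.cons_val, Matrix.of_apply, h₁, h₅, d₁, d₅]
    · linear_combination b3 + a4
    · linear_combination b14
    · linear_combination -a13
    · linear_combination a2
    · linear_combination b1
    · linear_combination b3 - a4
  have c23 : curvature (conn g h) (fun a => conn (dg a) (dh a)) 2 3 = weylMat w z 2 3 := by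
    apply hext <;> simp only [curvature, weylMat_apply, Fin.sum_univ_four, Matrix.mul_apply,
      Matrix.add_apply, Matrix.sub_apply, Matrix.smul_apply, Matrix.sum_apply, smul_eq_mul, conn,
      weylPair, Matrix.cons_val, Matrix.of_apply, h₁, h₅, d₁, d₅]
    · linear_combination a8 - b8
    · linear_combination b5
    · linear_combination a5
    · linear_combination a3 - b4
    · linear_combination b3 - a4
    · linear_combination -a8 - b8
  have hdiag (j) : curvature (conn g h) (fun a => conn (dg a) (dh a)) j j = weylMat w z j j := by
    ext b c
    have e₁ := congrFun (congrFun (curvature_swap (conn g h) (fun a => conn (dg a) (dh a)) j j) b) c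
    have e₂ := congrFun (congrFun (weylMat_swap w z j j) b) c
    rw [self_eq_neg.1 e₁, self_eq_neg.1 e₂]
  exact forall_of_pairs (P := fun j k =>
    curvature (conn g h) (fun a => conn (dg a) (dh a)) j k = weylMat w z j k)
    hdiag hswap c01 c20 c21 c30 c31 c23 j k

omit h₁ h₅ d₁ d₅ in
set_option linter.unusedSimpArgs false in
set_option maxHeartbeats 1000000 in
theorem connEqs_of_curvature_eq
    (R : ∀ j k b c, curvature (conn g h) (fun a => conn (dg a) (dh a)) j k b c
      = weylMat w z j k b c) :
    ConnEqs g h w (dg 0) (dg 1) (dg 2) (dg 3) (dh 0) (dh 1) := by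
  have r0102 := R 0 1 0 2
  have r0111 := R 0 1 1 1
  have r0113 := R 0 1 1 3
  have r2002 := R 2 0 0 2
  have r2011 := R 2 0 1 1
  have r2012 := R 2 0 1 2
  have r2033 := R 2 0 3 3
  have r2102 := R 2 1 0 2
  have r2103 := R 2 1 0 3
  have r2111 := R 2 1 1 1
  have r2113 := R 2 1 1 3
  have r2133 := R 2 1 3 3
  have r2302 := R 2 3 0 2
  have r2311 := R 2 3 1 1
  have r2312 := R 2 3 1 2
  have r2313 := R 2 3 1 3
  have r2333 := R 2 3 3 3
  have r3002 := R 3 0 0 2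
  have r3011 := R 3 0 1 1
  have r3013 := R 3 0 1 3
  have r3102 := R 3 1 0 2
  have r3111 := R 3 1 1 1
  have r3113 := R 3 1 1 3
  simp only [curvature, weylMat_apply, Fin.sum_univ_four, Matrix.mul_apply, Matrix.add_apply,
    Matrix.sub_apply, Matrix.smul_apply, Matrix.sum_apply, smul_eq_mul, conn, weylPair, Matrix.cons_val,
    Matrix.of_apply] at r0102 r0111 r0113 r2002 r2011 r2012 r2033 r2102 r2103 r2111 r2113 r2133 r2302 r2311 r2312 r2313 r2333 r3002 r3011 r3013 r3102 r3111 r3113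
  constructor
  · linear_combination r3002
  · linear_combination r3102
  -- Some entries contain one equation plus or minus the conjugate of another. Half sums and half
  -- differences of two or three such entries isolate the wanted equation.
  · linear_combination -(1/2 : ℂ) * r3011 + (1/2 : ℂ) * r2302
  · linear_combination (1/2 : ℂ) * r3111 - (1/2 : ℂ) * r2312
  · linear_combination r2313
  · linear_combination r2103
  · linear_combination r2113
  · linear_combination (1/2 : ℂ) * r2311 - (1/2 : ℂ) * r2333
  · linear_combination r0102
  · linear_combination (1/2 : ℂ) * r0111 + (1/2 : ℂ) * r2102 - (1/2 : ℂ) * r2012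
  · linear_combination r2102
  · linear_combination -r2002
  · linear_combination -r3113
  · linear_combination r3013
  · linear_combination (1/2 : ℂ) * r2011 - (1/2 : ℂ) * r2033
  · linear_combination (1/2 : ℂ) * r2111 - (1/2 : ℂ) * r2133
  · linear_combination r0113

end Algebra

/-! ### The structure equations for the frame -/

/-- The structure equations for the frame coefficients `e`, with `f = conj e`, `g = γ` and
`h = conj γ`: the derivatives of `e` along the frame are `D, Db, N, L`, and `D', N'` are derivatives
of `f`. -/
structure FrameEqs (e f : Fin 5 → ℂ) (g h : Fin 8 → ℂ) (D Db N L D' N' : Fin 5 → ℂ) : Prop where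
  L_e₁ : L 0 = -f 0 * g 0 - e 0 * g 1
  L_e₂ : L 1 = -f 1 * g 0 - e 1 * g 1
  N_e₃ : N 2 = e 2 * h 7 + e 2 * g 7
  L_e₄ : L 3 = -f 0 * h 3 + f 0 * h 4 + e 0 * h 2 + f 0 * g 2 - e 0 * g 3 + e 0 * g 4
  L_e₅ : L 4 = -f 1 * h 3 + f 1 * h 4 + e 1 * h 2 + f 1 * g 2 - e 1 * g 3 + e 1 * g 4
  t₁ : D' 0 - Db 0 = -f 0 * h 3 + e 0 * h 2 - f 0 * g 2 + e 0 * g 3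
  t₂ : D' 1 - Db 1 = -f 1 * h 3 + e 1 * h 2 - f 1 * g 2 + e 1 * g 3
  t₃ : D 2 = -e 2 * h 3 - e 2 * h 4 + e 2 * g 2
  t₄ : Db 3 - N' 0 = -f 0 * h 7 + f 0 * g 5 + e 0 * g 6 + f 0 * g 7
  t₅ : Db 4 - N' 1 = -f 1 * h 7 + f 1 * g 5 + e 1 * g 6 + f 1 * g 7

theorem FrameEqs.conj {e f : Fin 5 → ℂ} {g h : Fin 8 → ℂ} {D Db N L D' N' : Fin 5 → ℂ}
    (E : FrameEqs e f g h D Db N L D' N') :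
    FrameEqs (conj e) (conj f) (conj g) (conj h) (conj D) (conj Db) (conj N) (conj L) (conj D')
      (conj N') := by
  have key {a b : ℂ} (h : a = b) : starRingEnd ℂ a = starRingEnd ℂ b := congrArg _ h
  constructor
  · simpa using key E.L_e₁
  · simpa using key E.L_e₂
  · simpa using key E.N_e₃
  · simpa using key E.L_e₄
  · simpa using key E.L_e₅
  · simpa using key E.t₁
  · simpa using key E.t₂
  · simpa using key E.t₃
  · simpa using key E.t₄
  · simpa using key E.t₅

/-- The frame matrix as a function of `e` and `f = conj e`. -/
def frameTable (e f : Fin 5 → ℂ) : Matrix (Fin 4) (Fin 4) ℂ :=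
  !![e 0, e 1, 0, 0; f 0, f 1, 0, 0; e 3, e 4, 0, 1; 0, 0, e 2, 0]

/-- A derivative of the frame matrix, as a function of the derivatives of `e` and `f = conj e`. -/
def dframeTable (e f : Fin 5 → ℂ) : Matrix (Fin 4) (Fin 4) ℂ :=
  !![e 0, e 1, 0, 0; f 0, f 1, 0, 0; e 3, e 4, 0, 0; 0, 0, e 2, 0]

/-- The coordinate components of the torsion. -/
def torsionEntry (e f : Fin 5 → ℂ) (g h : Fin 8 → ℂ) (de df : Fin 4 → Fin 5 → ℂ) (a b μ : Fin 4) :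
    ℂ :=
  dframeTable (de a) (df a) b μ - dframeTable (de b) (df b) a μ
    - ∑ c, (conn g h a b c - conn g h b a c) * frameTable e f c μ

/-! ### Vanishing torsion as ten equations and their conjugates -/

section Algebra

variable {e f : Fin 5 → ℂ} {g h : Fin 8 → ℂ} {de df : Fin 4 → Fin 5 → ℂ}
  (h₁ : h 1 = g 1) (h₅ : h 5 = g 5)

include h₁ h₅

-- The ∂_u component (μ = 3) holds identically: among the frame fields only N has a ∂_u part, equal
-- to 1, and the N-component of Γ_{ab} is symmetric in a and b. The other components are equations
-- of `E` or `E'`, or hold identically.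
set_option linter.unusedSimpArgs false in
set_option maxHeartbeats 1000000 in
theorem torsionEntry_eq_zero_of_frameEqs (hf : ∀ i, 2 ≤ i → f i = e i)
    (hd : ∀ a i, 2 ≤ i → df a i = de a i)
    (E : FrameEqs e f g h (de 0) (de 1) (de 2) (de 3) (df 0) (df 2))
    (E' : FrameEqs f e h g (df 1) (df 0) (df 2) (df 3) (de 1) (de 2)) (a b μ : Fin 4) :
    torsionEntry e f g h de df a b μ = 0 := by
  have f₂ := hf 2 le_rfl
  have f₃ := hf 3 (by decide)
  have f₄ := hf 4 (by decide)
  have d₂ (a) := hd a 2 le_rfl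
  have d₃ (a) := hd a 3 (by decide)
  have d₄ (a) := hd a 4 (by decide)
  obtain ⟨a1, a2, a3, a4, a5, a6, a7, a8, a9, a10⟩ := E
  obtain ⟨b1, b2, b3, b4, b5, b6, b7, b8, b9, b10⟩ := E'
  simp only [h₁, h₅, f₂, f₃, f₄, d₂, d₃, d₄] at b1 b2 b3 b4 b5 b6 b7 b8 b9 b10
  have hswap (a b) (h' : ∀ μ, torsionEntry e f g h de df a b μ = 0) (μ) :
      torsionEntry e f g h de df b a μ = 0 := by
    rw [← neg_eq_zero, ← h' μ]
    simp only [torsionEntry, sub_mul, Finset.sum_sub_distrib]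
    ring
  have hdiag (a μ) : torsionEntry e f g h de df a a μ = 0 := by simp [torsionEntry]
  have c01 (μ : Fin 4) : torsionEntry e f g h de df 0 1 μ = 0 := by
    fin_cases μ <;>
      simp only [torsionEntry, Fin.sum_univ_four, conn, frameTable, dframeTable, Fin.reduceFinMk,
        Fin.zero_eta, Fin.mk_one, Matrix.cons_val, Matrix.of_apply, h₁, h₅]
    · linear_combination a6
    · linear_combination a7
    · ring
    · ring
  have c20 (μ : Fin 4) : torsionEntry e f g h de df 2 0 μ = 0 := by
    fin_cases μ <;>
      simp only [torsionEntry, Fin.sum_univ_four, conn, frameTable, dframeTable, Fin.reduceFinMk,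
        Fin.zero_eta, Fin.mk_one, Matrix.cons_val, Matrix.of_apply, h₁, h₅]
    · linear_combination -b9
    · linear_combination -b10
    · ring
    · ring
  have c21 (μ : Fin 4) : torsionEntry e f g h de df 2 1 μ = 0 := by
    fin_cases μ <;>
      simp only [torsionEntry, Fin.sum_univ_four, conn, frameTable, dframeTable, Fin.reduceFinMk,
        Fin.zero_eta, Fin.mk_one, Matrix.cons_val, Matrix.of_apply, h₁, h₅]
    · linear_combination -a9
    · linear_combination -a10
    · ring
    · ring
  have c30 (μ : Fin 4) : torsionEntry e f g h de df 3 0 μ = 0 := by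
    fin_cases μ <;>
      simp only [torsionEntry, Fin.sum_univ_four, conn, frameTable, dframeTable, Fin.reduceFinMk,
        Fin.zero_eta, Fin.mk_one, Matrix.cons_val, Matrix.of_apply, h₁, h₅]
    · linear_combination a1
    · linear_combination a2
    · linear_combination -a8
    · ring
  have c31 (μ : Fin 4) : torsionEntry e f g h de df 3 1 μ = 0 := by
    fin_cases μ <;>
      simp only [torsionEntry, Fin.sum_univ_four, conn, frameTable, dframeTable, Fin.reduceFinMk,
        Fin.zero_eta, Fin.mk_one, Matrix.cons_val, Matrix.of_apply, h₁, h₅]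
    · linear_combination b1
    · linear_combination b2
    · linear_combination -b8
    · ring
  have c23 (μ : Fin 4) : torsionEntry e f g h de df 2 3 μ = 0 := by
    fin_cases μ <;>
      simp only [torsionEntry, Fin.sum_univ_four, conn, frameTable, dframeTable, Fin.reduceFinMk,
        Fin.zero_eta, Fin.mk_one, Matrix.cons_val, Matrix.of_apply, h₁, h₅]
    · linear_combination -a4
    · linear_combination -a5
    · linear_combination a3
    · ring
  exact forall_of_pairs (P := fun a b => ∀ μ, torsionEntry e f g h de df a b μ = 0)
    hdiag hswap c01 c20 c21 c30 c31 c23 a b μ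

omit h₁ h₅ in
set_option linter.unusedSimpArgs false in
theorem frameEqs_of_torsionEntry_eq_zero
    (R : ∀ a b μ, torsionEntry e f g h de df a b μ = 0) :
    FrameEqs e f g h (de 0) (de 1) (de 2) (de 3) (df 0) (df 2) := by
  have r010 := R 0 1 0
  have r011 := R 0 1 1
  have r210 := R 2 1 0
  have r211 := R 2 1 1
  have r230 := R 2 3 0
  have r231 := R 2 3 1
  have r232 := R 2 3 2
  have r300 := R 3 0 0
  have r301 := R 3 0 1
  have r302 := R 3 0 2
  simp only [torsionEntry, Fin.sum_univ_four, conn, frameTable, dframeTable, Matrix.cons_val,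
    Matrix.of_apply] at r010 r011 r210 r211 r230 r231 r232 r300 r301 r302
  constructor
  · linear_combination r300
  · linear_combination r301
  · linear_combination r232
  · linear_combination -r230
  · linear_combination -r231
  · linear_combination r010
  · linear_combination r011
  · linear_combination -r302
  · linear_combination -r210
  · linear_combination -r211

end Algebra

/-! ### Translation into the rows of (SHS) and the components t, u -/

theorem rePart_apply (f : ScalarField) (x : Fin 4 → ℝ) :
    rePart f x = (f x + conj (f x)) / 2 := Complex.re_eq_add_conj _

theorem imPart_apply (f : ScalarField) (x : Fin 4 → ℝ) :
    imPart f x = (f x - conj (f x)) / (2 * Complex.I) := Complex.im_eq_sub_conj _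

theorem act_zero_left (f : ScalarField) : act 0 f = 0 := by
  funext x
  simp [act]

theorem applyOp_diagonal {n : ℕ} (d : Fin n → VecField) (ψ : Fin n → ScalarField) (i : Fin n)
    (x : Fin 4 → ℝ) : applyOp (Matrix.diagonal d) ψ i x = act (d i) (ψ i) x := by
  rw [applyOp, Finset.sum_eq_single i, Matrix.diagonal_apply_eq]
  · intro j _ hj
    rw [Matrix.diagonal_apply_ne _ hj.symm, act_zero_left]
    rfl
  · exact fun h => absurd (Finset.mem_univ i) h

/-- The values of `e` at `x`. -/
def eVal (Φ : (Fin 4 → ℝ) → FieldSpace) (x : Fin 4 → ℝ) : Fin 5 → ℂ := (eComp Φ · x)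

/-- The values of `conj e` at `x`. -/
def eBar (Φ : (Fin 4 → ℝ) → FieldSpace) (x : Fin 4 → ℝ) : Fin 5 → ℂ :=
  fun i => conj (eComp Φ i x)

/-- The frame derivatives of `e` at `x`. -/
def deVal (Φ : (Fin 4 → ℝ) → FieldSpace) (x : Fin 4 → ℝ) (a : Fin 4) : Fin 5 → ℂ :=
  fun i => act (frame Φ a) (eComp Φ i) x

/-- The frame derivatives of `conj e` at `x`. -/
def deBar (Φ : (Fin 4 → ℝ) → FieldSpace) (x : Fin 4 → ℝ) (a : Fin 4) : Fin 5 → ℂ :=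
  fun i => act (frame Φ a) (conj (eComp Φ i)) x

theorem frame_entry (Φ : (Fin 4 → ℝ) → FieldSpace) (b μ : Fin 4) :
    (fun y => frame Φ b y μ)
      = (!![eComp Φ 0, eComp Φ 1, 0, 0; conj (eComp Φ 0), conj (eComp Φ 1), 0, 0;
          eComp Φ 3, eComp Φ 4, 0, 1; 0, 0, eComp Φ 2, 0] : Matrix _ _ ScalarField) b μ := by
  fin_cases b <;> fin_cases μ <;> rfl

theorem act_frame (Φ : (Fin 4 → ℝ) → FieldSpace) (x : Fin 4 → ℝ) (a b μ : Fin 4) :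
    act (frame Φ a) (fun y => frame Φ b y μ) x = dframeTable (deVal Φ x a) (deBar Φ x a) b μ := by
  have h₀ : act (frame Φ a) 0 x = 0 := act_const _ 0 x
  have h₁ : act (frame Φ a) 1 x = 0 := act_const _ 1 x
  rw [frame_entry]
  fin_cases b <;> fin_cases μ <;> simp [dframeTable, deVal, deBar, h₀, h₁]

/-- The structure equations for the connection coefficients at the point `x`. -/
def ConnEqsAt (Φ : (Fin 4 → ℝ) → FieldSpace) (x : Fin 4 → ℝ) : Prop :=
  ConnEqs (gam Φ x) (gamBar Φ x) (wey Φ x) (dgam Φ x 0) (dgam Φ x 1) (dgam Φ x 2) (dgam Φ x 3)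
    (dgamBar Φ x 0) (dgamBar Φ x 1)

/-- The structure equations for the frame at the point `x`. -/
def FrameEqsAt (Φ : (Fin 4 → ℝ) → FieldSpace) (x : Fin 4 → ℝ) : Prop :=
  FrameEqs (eVal Φ x) (eBar Φ x) (gam Φ x) (gamBar Φ x) (deVal Φ x 0) (deVal Φ x 1) (deVal Φ x 2)
    (deVal Φ x 3) (deBar Φ x 0) (deBar Φ x 2)

set_option maxHeartbeats 1000000 in
theorem connEqsAt_iff (Φ : (Fin 4 → ℝ) → FieldSpace) (x : Fin 4 → ℝ) :
    ConnEqsAt Φ x ↔ (∀ i, applyOp (opA₂ Φ) (gammaComp Φ) i x = rhs₂ Φ i x) ∧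
      ∀ j, constraintU Φ j x = 0 := by
  simp only [opA₂, applyOp_diagonal]
  constructor
  · rintro ⟨a1, a2, a3, a4, a5, a6, a7, a8, a9, a10, a11, a12, a13, a14, a15, a16, a17⟩
    simp only [gam, gamBar, wey, dgam, dgamBar] at a1 a2 a3 a4 a5 a6 a7 a8 a9 a10 a11 a12 a13 a14 a15 a16 a17
    constructor
    · intro i
      fin_cases i <;> simp [rhs₂, rePart_apply]
      · linear_combination a1
      · linear_combination a2
      · linear_combination a3
      · linear_combination a4
      · linear_combination a5
      · linear_combination a6
      · linear_combination a7
      · linear_combination a8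
    · intro i
      fin_cases i <;> simp [constraintU]
      · linear_combination a9
      · linear_combination a10
      · linear_combination a11
      · linear_combination a12
      · linear_combination a13
      · linear_combination a14
      · linear_combination a15
      · linear_combination a16
      · linear_combination a17
  · rintro ⟨h, k⟩
    have a1 := h 0
    have a2 := h 1
    have a3 := h 2
    have a4 := h 3
    have a5 := h 4
    have a6 := h 5
    have a7 := h 6
    have a8 := h 7
    have a9 := k 0
    have a10 := k 1
    have a11 := k 2
    have a12 := k 3
    have a13 := k 4
    have a14 := k 5
    have a15 := k 6
    have a16 := k 7
    have a17 := k 8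
    simp [rhs₂, rePart_apply] at a1 a2 a3 a4 a5 a6 a7 a8
    simp [constraintU] at a9 a10 a11 a12 a13 a14 a15 a16 a17
    constructor <;> simp only [gam, gamBar, wey, dgam, dgamBar]
    · linear_combination a1
    · linear_combination a2
    · linear_combination a3
    · linear_combination a4
    · linear_combination a5
    · linear_combination a6
    · linear_combination a7
    · linear_combination a8
    · linear_combination a9
    · linear_combination a10
    · linear_combination a11
    · linear_combination a12
    · linear_combination a13
    · linear_combination a14
    · linear_combination a15
    · linear_combination a16
    · linear_combination a17

/-- Serves t₁ and t₂, which come from [D, D̄]. This commutator is purely imaginary, so its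
coordinate components amount to equality of an expression with its conjugate. -/
theorem neg_two_mul_imPart_eq_zero_iff (f : ScalarField) (x : Fin 4 → ℝ) :
    (-2 * imPart f : ScalarField) x = 0 ↔ f x = conj (f x) := by
  rw [Pi.mul_apply, imPart_apply, eq_comm (a := f x), ← sub_eq_zero (b := f x)]
  have hI : (2 * Complex.I) ≠ 0 := by simp
  constructor
  · intro h
    have h' : (f x - conj (f x)) / (2 * Complex.I) = 0 := by
      simpa using h
    rw [div_eq_zero_iff] at h'
    linear_combination -h'.resolve_right hI
  · intro h
    have h' : f x - conj (f x) = 0 := by linear_combination -h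
    rw [h', zero_div, mul_zero]

set_option maxHeartbeats 1000000 in
theorem frameEqsAt_iff (Φ : (Fin 4 → ℝ) → FieldSpace) (x : Fin 4 → ℝ) :
    FrameEqsAt Φ x ↔ (∀ i, applyOp (opA₁ Φ) (eComp Φ) i x = rhs₁ Φ i x) ∧
      ∀ j, constraintT Φ j x = 0 := by
  -- The conjugate of D(ē_j) is D̄(e_j), which turns the imaginary part in t_j into the difference
  -- D(ē_j) - D̄(e_j) of `FrameEqs`.
  have hc (j) : conj (act (frame Φ 0) (conj (eComp Φ j)) x) = act (frame Φ 1) (eComp Φ j) x := by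
    rw [← act_conj (X := frame Φ 1) (fun μ => by fin_cases μ <;> simp [frame, frameMatrix])]
    congr 1
    exact star_star (eComp Φ j)
  simp only [opA₁, applyOp_diagonal]
  constructor
  · rintro ⟨a1, a2, a3, a4, a5, a6, a7, a8, a9, a10⟩
    simp only [eVal, eBar, gam, gamBar, deVal, deBar] at a1 a2 a3 a4 a5 a6 a7 a8 a9 a10
    constructor
    · intro i
      fin_cases i <;> simp [rhs₁, rePart_apply]
      · linear_combination a1
      · linear_combination a2
      · linear_combination a3
      · linear_combination a4
      · linear_combination a5
    · intro i
      fin_cases i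
      · refine (neg_two_mul_imPart_eq_zero_iff _ _).2 ?_
        simp [hc]
        linear_combination a6
      · refine (neg_two_mul_imPart_eq_zero_iff _ _).2 ?_
        simp [hc]
        linear_combination a7
      all_goals simp [constraintT]
      · linear_combination a8
      · linear_combination a9
      · linear_combination a10
  · rintro ⟨h, k⟩
    have a1 := h 0
    have a2 := h 1
    have a3 := h 2
    have a4 := h 3
    have a5 := h 4
    have a6 := (neg_two_mul_imPart_eq_zero_iff _ _).1 (k 0)
    have a7 := (neg_two_mul_imPart_eq_zero_iff _ _).1 (k 1)
    have a8 := k 2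
    have a9 := k 3
    have a10 := k 4
    simp [rhs₁, rePart_apply] at a1 a2 a3 a4 a5
    simp [hc] at a6 a7
    simp [constraintT] at a8 a9 a10
    constructor <;> simp only [eVal, eBar, gam, gamBar, deVal, deBar]
    · linear_combination a1
    · linear_combination a2
    · linear_combination a3
    · linear_combination a4
    · linear_combination a5
    · linear_combination a6
    · linear_combination a7
    · linear_combination a8
    · linear_combination a9
    · linear_combination a10

/-! ### The second Bianchi identity -/

/-- One of the three cyclic summands of the covariant exterior derivative of a curvature `R` with frame
derivatives `dR`, for a torsion free connection with matrices `M`. -/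
def cyclicDerivative (M : Fin 4 → Matrix (Fin 4) (Fin 4) ℂ)
    (R : Fin 4 → Fin 4 → Matrix (Fin 4) (Fin 4) ℂ)
    (dR : Fin 4 → Fin 4 → Fin 4 → Matrix (Fin 4) (Fin 4) ℂ) (i j k : Fin 4) :
    Matrix (Fin 4) (Fin 4) ℂ :=
  dR i j k + R j k * M i - M i * R j k - ∑ c, (M j k c - M k j c) • R c i

/-- The cyclic sum of an array. -/
def cyc {A : Type*} [Add A] (f : Fin 4 → Fin 4 → Fin 4 → A) (i j k : Fin 4) : A :=
  f i j k + f j k i + f k i j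

/-- The algebra of the Bianchi identity, with derivatives as formal symbols. `dC` stands for the
derivatives of the structure coefficients C = M_{jk} - M_{kj}; `hJ` is the Jacobi identity of the
frame; `hR` says that mixed frame derivatives of M commute up to C, with the derivative of the
curvature already expanded. -/
theorem cyclicDerivative_curvature (M : Fin 4 → Matrix (Fin 4) (Fin 4) ℂ)
    (dM : Fin 4 → Fin 4 → Matrix (Fin 4) (Fin 4) ℂ)
    (dR : Fin 4 → Fin 4 → Fin 4 → Matrix (Fin 4) (Fin 4) ℂ)
    (dC : Fin 4 → Fin 4 → Fin 4 → Fin 4 → ℂ) (i j k : Fin 4)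
    (hJ : ∀ d, cyc (fun i j k => dC i j k d
      + ∑ c, (M j k c - M k j c) * (M i c d - M c i d)) i j k = 0)
    (hR : cyc (fun i j k => dR i j k
      - (dM i k * M j + M k * dM i j - (dM i j * M k + M j * dM i k))
      + ∑ d, (dC i j k d • M d + (M j k d - M k j d) • dM i d)) i j k
      = cyc (fun i j k => ∑ d, (M j k d - M k j d) • dM d i) i j k) :
    cyc (cyclicDerivative M (curvature M dM) dR) i j k = 0 := by
  -- The terms proportional to undifferentiated M have exactly the Jacobi expression as coefficient.
  have hT : cyc (fun i j k => ∑ d, dC i j k d • M d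
      - ∑ c, ∑ d, ((M j k c - M k j c) * (M c i d - M i c d)) • M d) i j k = 0 := by
    have h (i j k) : ∑ d, dC i j k d • M d
        - ∑ c, ∑ d, ((M j k c - M k j c) * (M c i d - M i c d)) • M d
        = ∑ d, (dC i j k d + ∑ c, (M j k c - M k j c) * (M i c d - M c i d)) • M d := by
      rw [Finset.sum_comm, ← Finset.sum_sub_distrib]
      refine Finset.sum_congr rfl fun d _ => ?_
      rw [← Finset.sum_smul, ← sub_smul, sub_eq_add_neg, ← Finset.sum_neg_distrib]
      congr 2
      exact Finset.sum_congr rfl fun c _ => by ring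
    simp only [cyc, h, ← Finset.sum_add_distrib, ← add_smul]
    refine Finset.sum_eq_zero fun d _ => ?_
    have e := hJ d
    simp only [cyc] at e
    rw [e, zero_smul]
  have hQ (i j k) : ∑ c, (M j k c - M k j c) • curvature M dM c i
      = ∑ c, (M j k c - M k j c) • dM c i - ∑ c, (M j k c - M k j c) • dM i c
        + (M i * ∑ c, (M j k c - M k j c) • M c) - (∑ c, (M j k c - M k j c) • M c) * M i
        - ∑ c, ∑ d, ((M j k c - M k j c) * (M c i d - M i c d)) • M d := by
    simp only [curvature, Finset.mul_sum, Finset.sum_mul, ← Finset.sum_sub_distrib,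
      ← Finset.sum_add_distrib, mul_smul, ← Finset.smul_sum, Matrix.mul_smul, Matrix.smul_mul,
      ← smul_sub, ← smul_add]
  have hX : cyc (cyclicDerivative M (curvature M dM) dR) i j k
      = (cyc (fun i j k => dR i j k
          - (dM i k * M j + M k * dM i j - (dM i j * M k + M j * dM i k))
          + ∑ d, (dC i j k d • M d + (M j k d - M k j d) • dM i d)) i j k
        - cyc (fun i j k => ∑ d, (M j k d - M k j d) • dM d i) i j k)
        - cyc (fun i j k => ∑ d, dC i j k d • M d
          - ∑ c, ∑ d, ((M j k c - M k j c) * (M c i d - M i c d)) • M d) i j k := by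
    simp only [cyc, cyclicDerivative, hQ, Finset.sum_add_distrib]
    simp only [curvature]
    noncomm_ring
  rw [hX, hR, hT, sub_self, sub_zero]

namespace Admissible

variable {U : Set (Fin 4 → ℝ)} {Φ : (Fin 4 → ℝ) → FieldSpace} (H : Admissible U Φ)
  {x : Fin 4 → ℝ} (hx : x ∈ U) (hconn : ∀ y ∈ U, ∀ a j k, koszul Φ a j k y = Gamma Φ a j k y)

include H hx hconn

theorem act_act_sub (i j : Fin 4) {f : ScalarField} (hf : ContDiffAt ℝ 2 f x) :
    act (frame Φ i) (act (frame Φ j) f) x - act (frame Φ j) (act (frame Φ i) f) x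
      = ∑ d, (cmat Φ x i j d - cmat Φ x j i d) * act (frame Φ d) f x := by
  rw [act_bracket (H.differentiableAt_frame hx i) (H.differentiableAt_frame hx j) hf]
  refine act_sum_left _ _ (fun μ => ?_) f
  have h := H.eq_sum_coeff hx (bracket (frame Φ i) (frame Φ j)) μ
  rw [H.coeff_bracket hx hconn] at h
  exact h

/-- This is d² = 0: in the cyclic sum the second derivatives pair up into commutators, and [F_j,
F_k] is expanded in the frame. It is applied to the frame components for `jacobi` and to the
connection entries for `bianchi`. -/
theorem cyc_act {p : Fin 4 → ScalarField} {S : Fin 4 → Fin 4 → ScalarField}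
    (hp : ∀ k, ContDiffAt ℝ 2 (p k) x)
    (hS : ∀ y ∈ U, ∀ j k, act (frame Φ j) (p k) y - act (frame Φ k) (p j) y = S j k y)
    (i j k : Fin 4) :
    cyc (fun i j k => act (frame Φ i) (S j k) x) i j k
      = cyc (fun i j k => ∑ d, (cmat Φ x j k d - cmat Φ x k j d) * act (frame Φ d) (p i) x)
        i j k := by
  have hd (j k) : DifferentiableAt ℝ (act (frame Φ j) (p k)) x :=
    differentiableAt_act (H.differentiableAt_frame hx j) (hp k)
  have h (i j k) : act (frame Φ i) (S j k) x = act (frame Φ i) (act (frame Φ j) (p k)) x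
      - act (frame Φ i) (act (frame Φ k) (p j)) x := by
    rw [← act_sub (hd j k) (hd k j)]
    exact act_congr (eventually_of_mem (H.mem_nhds hx) fun y hy => (hS y hy j k).symm) _
  simp only [cyc, h, ← H.act_act_sub hx hconn _ _ (hp _)]
  ring

theorem jacobi (i j k d : Fin 4) :
    cyc (fun i j k => (dcmat Φ x i j k d - dcmat Φ x i k j d)
      + ∑ c, (cmat Φ x j k c - cmat Φ x k j c) * (cmat Φ x i c d - cmat Φ x c i d)) i j k = 0 := by
  have hM (j b c) := (H.contDiffAt_cmat hx j b c).differentiableAt (by norm_num)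
  have hF := H.differentiableAt_frame hx
  have hS (y) (hy : y ∈ U) (j k μ : Fin 4) : act (frame Φ j) (fun y => frame Φ k y μ) y
      - act (frame Φ k) (fun y => frame Φ j y μ) y
      = ∑ d, (cmat Φ y j k d - cmat Φ y k j d) * frame Φ d y μ := by
    have h := H.eq_sum_coeff hy (bracket (frame Φ j) (frame Φ k)) μ
    rw [H.coeff_bracket hy hconn] at h
    exact h
  have key (μ : Fin 4) : ∑ d, cyc (fun i j k => (dcmat Φ x i j k d - dcmat Φ x i k j d)
      + ∑ c, (cmat Φ x j k c - cmat Φ x k j c) * (cmat Φ x i c d - cmat Φ x c i d)) i j k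
        * frame Φ d x μ = 0 := by
    have h := H.cyc_act hx hconn (fun k => H.contDiffAt_frame hx k μ)
      (fun y hy j k => hS y hy j k μ) i j k
    have hl (i j k : Fin 4) : act (frame Φ i)
        (fun y => ∑ d, (cmat Φ y j k d - cmat Φ y k j d) * frame Φ d y μ) x
        = ∑ d, ((dcmat Φ x i j k d - dcmat Φ x i k j d) * frame Φ d x μ
          + (cmat Φ x j k d - cmat Φ x k j d) * act (frame Φ i) (fun y => frame Φ d y μ) x) := by
      rw [act_sum fun d _ => ((hM j k d).fun_sub (hM k j d)).fun_mul (hF d μ)]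
      refine Finset.sum_congr rfl fun d _ => ?_
      rw [act_mul ((hM j k d).fun_sub (hM k j d)) (hF d μ), act_sub (hM j k d) (hM k j d),
        H.act_cmat hx, H.act_cmat hx]
    have hr (i j k : Fin 4) :
        ∑ d, ((dcmat Φ x i j k d - dcmat Φ x i k j d)
          + ∑ c, (cmat Φ x j k c - cmat Φ x k j c) * (cmat Φ x i c d - cmat Φ x c i d))
            * frame Φ d x μ
        = ∑ d, ((dcmat Φ x i j k d - dcmat Φ x i k j d) * frame Φ d x μ
          + (cmat Φ x j k d - cmat Φ x k j d) * act (frame Φ i) (fun y => frame Φ d y μ) x)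
          - ∑ d, (cmat Φ x j k d - cmat Φ x k j d) * act (frame Φ d) (fun y => frame Φ i y μ) x := by
      have e : ∑ d, (∑ c, (cmat Φ x j k c - cmat Φ x k j c) * (cmat Φ x i c d - cmat Φ x c i d))
            * frame Φ d x μ
          = ∑ c, (cmat Φ x j k c - cmat Φ x k j c) * (act (frame Φ i) (fun y => frame Φ c y μ) x
            - act (frame Φ c) (fun y => frame Φ i y μ) x) := by
        simp only [hS x hx, Finset.sum_mul, Finset.mul_sum, mul_assoc]
        exact Finset.sum_comm
      simp only [add_mul, Finset.sum_add_distrib, e]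
      simp only [mul_sub, Finset.sum_sub_distrib]
      ring
    simp only [cyc, hl] at h
    have e := congrArg₂ (· + ·) (congrArg₂ (· + ·) (hr i j k) (hr j k i)) (hr k i j)
    refine Eq.trans ?_ (e.trans ?_)
    · simp only [cyc, ← Finset.sum_add_distrib]
      exact Finset.sum_congr rfl fun d _ => by ring
    · linear_combination h
  -- By `key` the cyclic sums are coefficients of the zero vector, hence vanish.
  have h₁ : coeff Φ 0 x = fun d => cyc (fun i j k => (dcmat Φ x i j k d - dcmat Φ x i k j d)
      + ∑ c, (cmat Φ x j k c - cmat Φ x k j c) * (cmat Φ x i c d - cmat Φ x c i d)) i j k :=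
    (H.coeff_eq_iff hx).2 fun μ => (key μ).symm
  have h₂ : coeff Φ 0 x = 0 := Matrix.zero_vecMul _
  exact congrFun (h₁.symm.trans h₂) d

theorem bianchi (hcurv : ∀ y ∈ U, ∀ j k,
      curvature (cmat Φ y) (dcmat Φ y) j k = weylMat (wey Φ y) (weyBar Φ y) j k)
    (i j k : Fin 4) :
    cyc (cyclicDerivative (cmat Φ x) (weylMat (wey Φ x) (weyBar Φ x))
      (fun i => weylMat (dwey Φ x i) (dweyBar Φ x i))) i j k = 0 := by
  have hM (j b c) := (H.contDiffAt_cmat hx j b c).differentiableAt (by norm_num)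
  have hW (j k b c) : DifferentiableAt ℝ (fun y => weylMat (wey Φ y) (weyBar Φ y) j k b c) x :=
    (H.contDiffAt_weylMat hx j k b c).differentiableAt (by norm_num)
  have hcx : curvature (cmat Φ x) (dcmat Φ x) = weylMat (wey Φ x) (weyBar Φ x) :=
    funext fun j => funext fun k => hcurv x hx j k
  rw [← hcx]
  refine cyclicDerivative_curvature _ _ _
    (fun i j k d => dcmat Φ x i j k d - dcmat Φ x i k j d) i j k
    (H.jacobi hx hconn i j k) ?_
  ext b c
  -- The curvature equation solved for F_j(M_k) - F_k(M_j), with the curvature already replaced by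
  -- W. Differentiating it thus produces first derivatives of w.
  have hS (y) (hy : y ∈ U) (j k : Fin 4) : act (frame Φ j) (fun y => cmat Φ y k b c) y
      - act (frame Φ k) (fun y => cmat Φ y j b c) y
      = weylMat (wey Φ y) (weyBar Φ y) j k b c
        - (∑ d, cmat Φ y k b d * cmat Φ y j d c - ∑ d, cmat Φ y j b d * cmat Φ y k d c)
        + ∑ d, (cmat Φ y j k d - cmat Φ y k j d) * cmat Φ y d b c := by
    rw [H.act_cmat hy, H.act_cmat hy, ← hcurv y hy]
    simp only [curvature, Matrix.sub_apply, Matrix.add_apply, Matrix.sum_apply, Matrix.smul_apply,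
      smul_eq_mul, Matrix.mul_apply]
    ring
  have h := H.cyc_act hx hconn (fun k => H.contDiffAt_cmat hx k b c) hS i j k
  have hmm (j k : Fin 4) :
      DifferentiableAt ℝ (fun y => ∑ d, cmat Φ y k b d * cmat Φ y j d c) x :=
    DifferentiableAt.fun_sum fun d _ => (hM k b d).fun_mul (hM j d c)
  have hcm (j k : Fin 4) (d : Fin 4) :
      DifferentiableAt ℝ (fun y => (cmat Φ y j k d - cmat Φ y k j d) * cmat Φ y d b c) x :=
    ((hM j k d).fun_sub (hM k j d)).fun_mul (hM d b c)
  have ham (i j k : Fin 4) : act (frame Φ i) (fun y => ∑ d, cmat Φ y k b d * cmat Φ y j d c) x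
      = (dcmat Φ x i k * cmat Φ x j + cmat Φ x k * dcmat Φ x i j) b c := by
    rw [act_sum fun d _ => (hM k b d).fun_mul (hM j d c)]
    simp only [Matrix.add_apply, Matrix.mul_apply, ← Finset.sum_add_distrib]
    refine Finset.sum_congr rfl fun d _ => ?_
    rw [act_mul (hM k b d) (hM j d c), H.act_cmat hx, H.act_cmat hx]
  have hac (i j k : Fin 4) : act (frame Φ i)
      (fun y => ∑ d, (cmat Φ y j k d - cmat Φ y k j d) * cmat Φ y d b c) x
      = (∑ d, ((dcmat Φ x i j k d - dcmat Φ x i k j d) • cmat Φ x d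
        + (cmat Φ x j k d - cmat Φ x k j d) • dcmat Φ x i d)) b c := by
    rw [act_sum fun d _ => hcm j k d]
    simp only [Matrix.sum_apply, Matrix.add_apply, Matrix.smul_apply, smul_eq_mul]
    refine Finset.sum_congr rfl fun d _ => ?_
    rw [act_mul ((hM j k d).fun_sub (hM k j d)) (hM d b c), act_sub (hM j k d) (hM k j d),
      H.act_cmat hx, H.act_cmat hx, H.act_cmat hx]
  have hl (i j k : Fin 4) : act (frame Φ i) (fun y => weylMat (wey Φ y) (weyBar Φ y) j k b c
        - (∑ d, cmat Φ y k b d * cmat Φ y j d c - ∑ d, cmat Φ y j b d * cmat Φ y k d c)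
        + ∑ d, (cmat Φ y j k d - cmat Φ y k j d) * cmat Φ y d b c) x
      = (weylMat (dwey Φ x i) (dweyBar Φ x i) j k
        - (dcmat Φ x i k * cmat Φ x j + cmat Φ x k * dcmat Φ x i j
          - (dcmat Φ x i j * cmat Φ x k + cmat Φ x j * dcmat Φ x i k))
        + ∑ d, ((dcmat Φ x i j k d - dcmat Φ x i k j d) • cmat Φ x d
          + (cmat Φ x j k d - cmat Φ x k j d) • dcmat Φ x i d)) b c := by
    rw [act_add ((hW j k b c).fun_sub ((hmm j k).fun_sub (hmm k j)))
        (DifferentiableAt.fun_sum fun d _ => hcm j k d),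
      act_sub (hW j k b c) ((hmm j k).fun_sub (hmm k j)), act_sub (hmm j k) (hmm k j),
      H.act_weylMat hx, ham, ham, hac]
    rfl
  simp only [cyc, hl, H.act_cmat hx] at h
  simp only [cyc, Matrix.add_apply _ _ b c] at h ⊢
  rw [h]
  simp only [Matrix.sum_apply, Matrix.smul_apply, smul_eq_mul]

end Admissible

/-- The equations for the Weyl components `w` that follow from the second Bianchi identity, with
`g = γ` and `h = conj γ`: the derivatives of `w` along the frame are `D, Db, N, L`. -/
structure WeylEqs (g h : Fin 8 → ℂ) (w D Db N L : Fin 5 → ℂ) : Prop where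
  N_w₁ : D 1 + N 0 = -g 5 * w 0 + 4 * g 7 * w 0 - 4 * h 3 * w 1 + 6 * g 2 * w 1 - 3 * g 0 * w 2
  N_w₂ : D 2 + N 1 = -2 * g 5 * w 1 + 2 * g 7 * w 1 - 3 * h 3 * w 2 + 3 * g 2 * w 2 - 2 * g 0 * w 3
  N_w₃ : D 3 + N 2 = -3 * g 5 * w 2 - 2 * h 3 * w 3 - g 0 * w 4
  N_w₄ : D 4 + N 3 = -4 * g 5 * w 3 - 2 * g 7 * w 3 - h 3 * w 4 - 3 * g 2 * w 4
  L_w₂ : Db 0 + L 1 = -4 * g 3 * w 0 - g 4 * w 0 - 4 * g 1 * w 1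
  L_w₃ : Db 1 + L 2 = -g 6 * w 0 - 2 * g 3 * w 1 - 2 * g 4 * w 1 - 3 * g 1 * w 2
  L_w₄ : Db 2 + L 3 = -2 * g 6 * w 1 - 3 * g 4 * w 2 - 2 * g 1 * w 3
  L_w₅ : Db 3 + L 4 = -3 * g 6 * w 2 + 2 * g 3 * w 3 - 4 * g 4 * w 3 - g 1 * w 4

-- Ten components of the Bianchi identity suffice for the eight equations.
set_option linter.unusedSimpArgs false in
set_option maxHeartbeats 1000000 in
theorem weylEqs_of_bianchi {g h : Fin 8 → ℂ} {w z : Fin 5 → ℂ} {dw dz : Fin 4 → Fin 5 → ℂ}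
    (R : ∀ i j k b c, cyc (cyclicDerivative (conn g h) (weylMat w z)
      (fun i => weylMat (dw i) (dz i))) i j k b c = 0) :
    WeylEqs g h w (dw 0) (dw 1) (dw 2) (dw 3) := by
  simp only [cyc, Matrix.add_apply] at R
  have r023_02 := R 0 2 3 0 2
  have r023_11 := R 0 2 3 1 1
  have r013_03 := R 0 1 3 0 3
  have r012_11 := R 0 1 2 1 1
  have r123_03 := R 1 2 3 0 3
  have r012_13 := R 0 1 2 1 3
  have r013_02 := R 0 1 3 0 2
  have r123_02 := R 1 2 3 0 2
  have r013_13 := R 0 1 3 1 3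
  have r123_13 := R 1 2 3 1 3
  simp only [cyclicDerivative, weylMat_apply, Fin.sum_univ_four, Matrix.mul_apply, Matrix.add_apply,
    Matrix.sub_apply, Matrix.smul_apply, Matrix.sum_apply, smul_eq_mul, conn, weylPair, Matrix.cons_val,
    Matrix.of_apply] at r023_02 r023_11 r013_03 r012_11 r123_03 r012_13 r013_02 r123_02 r013_13 r123_13
  constructor
  · linear_combination -r023_02
  -- The diagonal entry also carries -D(w̄₃) - L(w̄₄), which is precisely the derivative part of the
  -- subtracted entry. The next equation removes D̄(w̄₄) + N(w̄₃) in the same way.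
  · linear_combination r023_11 - r013_03
  · linear_combination r012_11 - r123_03
  · linear_combination r012_13
  · linear_combination -r013_02
  · linear_combination -r123_02
  · linear_combination r013_13
  · linear_combination r123_13

/-! ### Vacuum fields and the structure equations -/

theorem coordDeriv_coord (μ ν : Fin 4) (x : Fin 4 → ℝ) :
    coordDeriv μ (fun y => (y ν : ℂ)) x = if μ = ν then 1 else 0 := by
  have h : HasFDerivAt (fun y : Fin 4 → ℝ => (y ν : ℂ))
      (Complex.ofRealCLM.comp (ContinuousLinearMap.proj ν)) x :=
    (Complex.ofRealCLM.comp (ContinuousLinearMap.proj ν : (Fin 4 → ℝ) →L[ℝ] ℝ)).hasFDerivAt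
  rw [coordDeriv, h.fderiv]
  simp [Pi.single_apply, eq_comm, apply_ite]

theorem act_coord (X : VecField) (ν : Fin 4) (x : Fin 4 → ℝ) :
    act X (fun y => (y ν : ℂ)) x = X x ν := by
  simp [act, coordDeriv_coord]

/-- Five rows and three constraints against eight equations: the outer rows are single equations,
each middle row is an N-equation plus an L-equation, and v repeats the L-equations of w₂, w₃, w₄. -/
theorem weylEqs_solves {Φ : (Fin 4 → ℝ) → FieldSpace} {x : Fin 4 → ℝ}
    (E : WeylEqs (gam Φ x) (gamBar Φ x) (wey Φ x) (dwey Φ x 0) (dwey Φ x 1) (dwey Φ x 2)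
      (dwey Φ x 3)) :
    (∀ i, applyOp (opA₃ (fun _ _ => 1) Φ) (wComp Φ) i x = rhs₃ (fun _ _ => 1) Φ i x) ∧
      ∀ j, constraintV (fun _ _ => 1) Φ j x = 0 := by
  obtain ⟨a1, a2, a3, a4, a5, a6, a7, a8⟩ := E
  simp only [gam, gamBar, wey, dwey] at a1 a2 a3 a4 a5 a6 a7 a8
  have hs (X : VecField) : scale (fun _ => 1) X = X := by
    funext x μ
    simp [scale]
  have ha (X Y : VecField) (f : ScalarField) : act (X + Y) f x = act X f x + act Y f x := by
    simp [act, add_mul, Finset.sum_add_distrib]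
  constructor
  · intro i
    fin_cases i <;> simp [applyOp, opA₃, rhs₃, hs, ha, Fin.sum_univ_succ, act_zero_left]
    · linear_combination a1
    · linear_combination a2 + a5
    · linear_combination a3 + a6
    · linear_combination a4 + a7
    · linear_combination a8
  · intro j
    fin_cases j <;> simp [constraintV]
    · linear_combination a5
    · linear_combination a6
    · linear_combination a7

/-! ### Complex conjugation, and the two equivalences at a point -/

namespace Admissible

variable {U : Set (Fin 4 → ℝ)} {Φ : (Fin 4 → ℝ) → FieldSpace} (H : Admissible U Φ)
  {x : Fin 4 → ℝ} (hx : x ∈ U)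

include H hx

/-- Conjugation exchanges D and D̄, whence the permutation, and fixes N and L because e₃, e₄, e₅ are
real. -/
theorem act_frame_conj (a : Fin 4) (f : ScalarField) :
    act (frame Φ (![1, 0, 2, 3] a)) (conj f) x = conj (act (frame Φ a) f x) := by
  have h₂ := H.conj_eComp hx (j := 2) le_rfl
  have h₃ := H.conj_eComp hx (j := 3) (by decide)
  have h₄ := H.conj_eComp hx (j := 4) (by decide)
  refine act_conj (fun μ => ?_) f
  fin_cases a <;> fin_cases μ <;> simp [frame, frameMatrix, h₂, h₃, h₄]

theorem act_conj_eComp (a : Fin 4) {i : Fin 5} (hi : 2 ≤ i) :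
    deBar Φ x a i = deVal Φ x a i :=
  act_congr (eventually_of_mem (H.mem_nhds hx) fun _ hy => H.conj_eComp hy hi) _

theorem dgamBar_one (a : Fin 4) : dgamBar Φ x a 1 = dgam Φ x a 1 :=
  act_congr (eventually_of_mem (H.mem_nhds hx) fun _ hy => H.conj_gammaComp_one hy) _

theorem dgamBar_five (a : Fin 4) : dgamBar Φ x a 5 = dgam Φ x a 5 :=
  act_congr (eventually_of_mem (H.mem_nhds hx) fun _ hy => H.conj_gammaComp_five hy) _

theorem deBar_eq (a : Fin 4) : deBar Φ x (![1, 0, 2, 3] a) = conj (deVal Φ x a) :=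
  funext fun _ => H.act_frame_conj hx a _

theorem dgamBar_eq (a : Fin 4) : dgamBar Φ x (![1, 0, 2, 3] a) = conj (dgam Φ x a) :=
  funext fun _ => H.act_frame_conj hx a _

theorem frameEqs_conj (E : FrameEqsAt Φ x) :
    FrameEqs (eBar Φ x) (eVal Φ x) (gamBar Φ x) (gam Φ x) (deBar Φ x 1) (deBar Φ x 0) (deBar Φ x 2)
      (deBar Φ x 3) (deVal Φ x 1) (deVal Φ x 2) := by
  have h (a) := H.deBar_eq hx a
  have h₁ : deVal Φ x 1 = conj (deBar Φ x 0) := by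
    rw [show deBar Φ x 0 = conj (deVal Φ x 1) from h 1]
    exact (star_star _).symm
  have h₂ : deVal Φ x 2 = conj (deBar Φ x 2) := by
    rw [show deBar Φ x 2 = conj (deVal Φ x 2) from h 2]
    exact (star_star _).symm
  have e₁ : eVal Φ x = conj (eBar Φ x) := (star_star (eVal Φ x)).symm
  have e₂ : gam Φ x = conj (gamBar Φ x) := (star_star (gam Φ x)).symm
  have E' := E.conj
  rwa [← h₁, ← h₂, ← e₁, ← e₂, ← show deBar Φ x 1 = _ from h 0, ← show deBar Φ x 0 = _ from h 1,
    ← show deBar Φ x 2 = _ from h 2, ← show deBar Φ x 3 = _ from h 3] at E'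

theorem connEqs_conj (E : ConnEqsAt Φ x) :
    ConnEqs (gamBar Φ x) (gam Φ x) (weyBar Φ x) (dgamBar Φ x 1) (dgamBar Φ x 0) (dgamBar Φ x 2)
      (dgamBar Φ x 3) (dgam Φ x 1) (dgam Φ x 0) := by
  have h (a) := H.dgamBar_eq hx a
  have h₁ : dgam Φ x 1 = conj (dgamBar Φ x 0) := by
    rw [show dgamBar Φ x 0 = conj (dgam Φ x 1) from h 1]
    exact (star_star _).symm
  have h₂ : dgam Φ x 0 = conj (dgamBar Φ x 1) := by
    rw [show dgamBar Φ x 1 = conj (dgam Φ x 0) from h 0]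
    exact (star_star _).symm
  have e₂ : gam Φ x = conj (gamBar Φ x) := (star_star (gam Φ x)).symm
  have E' := E.conj
  rwa [← h₁, ← h₂, ← e₂, ← show dgamBar Φ x 1 = _ from h 0, ← show dgamBar Φ x 0 = _ from h 1,
    ← show dgamBar Φ x 2 = _ from h 2, ← show dgamBar Φ x 3 = _ from h 3] at E'

/-- The Levi-Civita connection has the coefficients `Γ` if and only if the frame equations hold. -/
theorem connection_iff_frameEqs :
    (∀ a j k, koszul Φ a j k x = Gamma Φ a j k x) ↔ FrameEqsAt Φ x := by
  have h₁ : gamBar Φ x 1 = gam Φ x 1 := H.conj_gammaComp_one hx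
  have h₅ : gamBar Φ x 5 = gam Φ x 5 := H.conj_gammaComp_five hx
  have ht : (∀ a j k, koszul Φ a j k x = Gamma Φ a j k x) ↔ ∀ a b μ,
      torsionEntry (eVal Φ x) (eBar Φ x) (gam Φ x) (gamBar Φ x) (deVal Φ x) (deBar Φ x) a b μ
        = 0 := by
    rw [H.koszul_eq_Gamma_iff hx]
    refine forall_congr' fun a => forall_congr' fun b => ?_
    rw [H.coeff_eq_iff hx]
    refine forall_congr' fun μ => ?_
    rw [torsionEntry, sub_eq_zero, ← act_frame, ← act_frame]
    rfl
  rw [ht]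
  constructor
  · exact frameEqs_of_torsionEntry_eq_zero
  · intro E
    exact torsionEntry_eq_zero_of_frameEqs h₁ h₅ (fun i hi => H.conj_eComp hx hi)
      (fun a i hi => H.act_conj_eComp hx a hi) E (H.frameEqs_conj hx E)

/-- The curvature equations hold if and only if the structure equations for the connection
coefficients hold. -/
theorem curvature_iff_connEqs :
    (∀ j k, curvature (cmat Φ x) (dcmat Φ x) j k = weylMat (wey Φ x) (weyBar Φ x) j k) ↔
      ConnEqsAt Φ x := by
  have h₁ : gamBar Φ x 1 = gam Φ x 1 := H.conj_gammaComp_one hx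
  have h₅ : gamBar Φ x 5 = gam Φ x 5 := H.conj_gammaComp_five hx
  constructor
  · intro h
    exact connEqs_of_curvature_eq fun j k b c => congrFun (congrFun (h j k) b) c
  · intro E
    exact curvature_eq_of_connEqs h₁ h₅ (H.dgamBar_one hx) (H.dgamBar_five hx) E
      (H.connEqs_conj hx E)

/-! ### Eikonal equations, gradients and null geodesics -/

omit H hx in
-- L is the only frame field with a ∂_u̲ component and g⁴⁴ = 0. For u the same argument uses N and
-- g³³ = 0.
theorem solvesEikonal_ubar : SolvesEikonal U Φ ubarCoord := by
  intro x _
  have h (a) : act (frame Φ a) ubarCoord x = frame Φ a x 2 := act_coord _ 2 x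
  simp [h, Fin.sum_univ_four, gUpper, frame, frameMatrix]

omit H hx in
theorem solvesEikonal_u : SolvesEikonal U Φ uCoord := by
  intro x _
  have h (a) : act (frame Φ a) uCoord x = frame Φ a x 3 := act_coord _ 3 x
  simp [h, Fin.sum_univ_four, gUpper, frame, frameMatrix]

omit H hx in
theorem scale_frame_two_eq (x : Fin 4 → ℝ) :
    scale (eComp Φ 2) (frame Φ 2) x = -gradient Φ ubarCoord x := by
  have h (a) : act (frame Φ a) ubarCoord x = frame Φ a x 2 := act_coord _ 2 x
  funext μ
  simp only [scale, gradient, Pi.neg_apply, h, Fin.sum_univ_four]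
  simp [gUpper, frame, frameMatrix]

omit H hx in
theorem frame_three_eq (x : Fin 4 → ℝ) : frame Φ 3 x = -gradient Φ uCoord x := by
  have h (a) : act (frame Φ a) uCoord x = frame Φ a x 3 := act_coord _ 3 x
  funext μ
  simp only [gradient, Pi.neg_apply, h, Fin.sum_univ_four]
  simp [gUpper, frame, frameMatrix]

theorem coeff_scale_frame (f : ScalarField) (a : Fin 4) :
    coeff Φ (scale f (frame Φ a)) x = Pi.single a (f x) :=
  (H.coeff_eq_iff hx).2 fun μ => by simp [scale, Pi.single_apply]

theorem eq_zero_of_coeff {X : VecField} (h : ∀ c, coeff Φ X x c = 0) : X x = 0 := by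
  funext μ
  simp [H.eq_sum_coeff hx X μ, h]

-- L is geodesic because the fourth row of the matrix Γ₄ is zero.
omit hx in
theorem isNullGeodesic_frame_three
    (hconn : ∀ y ∈ U, ∀ a j k, koszul Φ a j k y = Gamma Φ a j k y) :
    IsNullGeodesic U Φ (frame Φ 3) := by
  intro x hx
  constructor
  · rw [H.metric_frame_left hx, H.coeff_frame hx]
    simp [Pi.single_apply, gLower]
  · refine H.eq_zero_of_coeff hx fun c => ?_
    rw [H.coeff_covDeriv_frame hx hconn, H.coeff_frame hx]
    fin_cases c <;> simp [Pi.single_apply, cmat, conn]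

-- The table gives ∇_N N = -2 Re(γ₈) N, and N(e₃) = 2e₃ Re γ₈ is the rescaling that makes the
-- parametrization of e₃N affine.
omit hx in
theorem isNullGeodesic_scale_frame_two
    (hconn : ∀ y ∈ U, ∀ a j k, koszul Φ a j k y = Gamma Φ a j k y) :
    IsNullGeodesic U Φ (scale (eComp Φ 2) (frame Φ 2)) := by
  intro x hx
  constructor
  · simp [metric, H.coeff_scale_frame hx, Pi.single_apply, gLower]
  · refine H.eq_zero_of_coeff hx fun c => ?_
    have hN := ((H.connection_iff_frameEqs hx).1 (hconn x hx)).N_e₃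
    simp only [deVal, eVal, gam, gamBar] at hN
    have hs (f : ScalarField) : act (scale (eComp Φ 2) (frame Φ 2)) f x
        = eComp Φ 2 x * act (frame Φ 2) f x := by
      simp [act, scale, Finset.mul_sum, mul_assoc]
    have hc : (fun y => coeff Φ (scale (eComp Φ 2) (frame Φ 2)) y c)
        =ᶠ[𝓝 x] fun y => (Pi.single 2 (eComp Φ 2 y) : Fin 4 → ℂ) c :=
      eventually_of_mem (H.mem_nhds hx) fun y hy => by simp only [H.coeff_scale_frame hy]
    rw [H.coeff_covDeriv hx hconn]
    beta_reduce
    rw [act_congr hc, hs, H.coeff_scale_frame hx]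
    fin_cases c <;> simp [Pi.single_apply, cmat, conn, act_const]
    simp only [gam, gamBar]
    linear_combination eComp Φ 2 x * hN

end Admissible

end Wavefront

end

/-! ### The equivalence -/

theorem mainTheorem6 (U : Set (Fin 4 → ℝ)) (hU : IsOpen U)
    (Φ : (Fin 4 → ℝ) → Wavefront.FieldSpace)
    (hΦ : ContDiffOn ℝ 2 Φ U)
    (hrange : ∀ x ∈ U, Φ x ∈ Wavefront.fieldRange)
    (hstar : Wavefront.ConditionStar U Φ)
    (hstarstar : Wavefront.ConditionStarStar U Φ) :
    Wavefront.IsVacuumField U Φ ↔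
      ∃ lam : Fin 4 → (Fin 4 → ℝ) → ℝ,
        (∀ i, ∀ x ∈ U, 0 < lam i x) ∧
        Wavefront.SolvesSHS U lam Φ ∧
        ∀ x ∈ U, Wavefront.constraintField lam Φ x = 0 := by
  have H : Wavefront.Admissible U Φ := ⟨hU, hΦ, hrange, hstar, hstarstar⟩
  constructor
  · intro V
    have hcurv (y) (hy : y ∈ U) :=
      (H.riemann_eq_Weyl_iff hy V.connection).1 (V.curvature y hy)
    have key (x) (hx : x ∈ U) :=
      Wavefront.weylEqs_solves <| Wavefront.weylEqs_of_bianchi fun i j k b c =>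
        congrFun (congrFun (H.bianchi hx V.connection hcurv i j k) b) c
    have hframe (x) (hx : x ∈ U) := (Wavefront.frameEqsAt_iff Φ x).1
      ((H.connection_iff_frameEqs hx).1 (V.connection x hx))
    have hconn (x) (hx : x ∈ U) := (Wavefront.connEqsAt_iff Φ x).1
      ((H.curvature_iff_connEqs hx).1 (hcurv x hx))
    -- The Bianchi equations hold one by one, so any positive weights would do; 1 is the simplest
    -- choice.
    refine ⟨fun _ _ => 1, fun _ _ _ => one_pos,
      fun x hx => ⟨(hframe x hx).1, (hconn x hx).1, (key x hx).1⟩, fun x hx => ?_⟩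
    exact Prod.ext (funext (hframe x hx).2) (Prod.ext (funext (hconn x hx).2) (funext (key x hx).2))
  · rintro ⟨lam, -, hshs, hcon⟩
    have hT (x) (hx : x ∈ U) (j) : Wavefront.constraintT Φ j x = 0 :=
      congrFun (congrArg Prod.fst (hcon x hx)) j
    have hU' (x) (hx : x ∈ U) (j) : Wavefront.constraintU Φ j x = 0 :=
      congrFun (congrArg (fun p => p.2.1) (hcon x hx)) j
    have hconn : ∀ x ∈ U, ∀ a j k, Wavefront.koszul Φ a j k x = Wavefront.Gamma Φ a j k x :=
      fun x hx => (H.connection_iff_frameEqs hx).2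
        ((Wavefront.frameEqsAt_iff Φ x).2 ⟨(hshs x hx).1, hT x hx⟩)
    exact
      { star := hstar
        starStar := hstarstar
        connection := hconn
        curvature := fun x hx => (H.riemann_eq_Weyl_iff hx hconn).2
          ((H.curvature_iff_connEqs hx).2
            ((Wavefront.connEqsAt_iff Φ x).2 ⟨(hshs x hx).2.1, hU' x hx⟩))
        eikonal_ubar := Wavefront.Admissible.solvesEikonal_ubar
        eikonal_u := Wavefront.Admissible.solvesEikonal_u
        gradient_ubar := fun x _ => Wavefront.Admissible.scale_frame_two_eq x
        gradient_u := fun x _ => Wavefront.Admissible.frame_three_eq x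
        geodesic_ubar := H.isNullGeodesic_scale_frame_two hconn
        geodesic_u := H.isNullGeodesic_frame_three hconn }
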